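/- Let $N\ge 1$ servers and $M\ge 1$ message sets be given, together with a storage pattern $\mathcal R=(\mathcal R_1,\dots,\mathcal R_M)$ of nonempty sets $\mathcal R_m\subseteq\{1,\dots,N\}$, $\rho_m=|\mathcal R_m|$, and thresholds $0\le X<N$, $1\le T<N$. Fix a finite field $\mathbb F_q$. The $m$-th message set consists of $K_m$ messages $W_{m,k}\in\mathbb F_q^L$, $k=1,\dots,K_m$, and the symbols of all messages are i.i.d. uniform. An $X$-secure $T$-private information retrieval scheme with graph based replicated storage (GXSTPIR scheme) of message length $L\ge 1$ consists of random variables with finite alphabets as follows. For every $n\in\mathcal R_m$, server $n$ stores a share of $W_{m,k}$; each message is determined by all of its shares; the families of shares of different messages are mutually independent; and the joint storage of any $X$ servers is independent of the messages. The user wants $W_\theta$ for a uniformly distributed index $\theta=(m,k)$ and sends a query $Q_n$ to each server $n$, where $(\theta,Q_1,\dots,Q_N)$ is independent of the storage of all servers, and the queries to any $T$ servers are jointly independent of $\theta$. Server $n$ returns a string of $q$-ary symbols that is a function of $Q_n$ and of its storage, the possible strings for each value of $Q_n$ forming a prefix-free set (for instance, strings of a fixed length). The message $W_\theta$ is determined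 by all answers, all queries and $\theta$. The rate of the scheme is $L/D$, where $D$ is the expected total number of $q$-ary symbols in the answers. The capacity $C(K_1,\dots,K_M)$ is the supremum of the rates of all such schemes over all $L\ge 1$, and the asymptotic capacity is $C_\infty(\mathcal R)=\lim_{K_1,\dots,K_M\to\infty}C(K_1,\dots,K_M)$. Then this limit exists and $$C_\infty(\mathcal R)=\begin{cases}0,&\min_m\rho_m\le X+T,\\ \max_{(D_1,\dots,D_N)\in\mathcal D}\Big(\sum_{n=1}^N D_n\Big)^{-1},&\min_m\rho_m> X+T,\end{cases}$$ where $$\mathcal D=\Big\{(D_1,\dots,D_N)\in\mathbb R_{\ge 0}^N\ :\ \sum_{n\in\mathcal R'}D_n\ge 1\ \text{ for all } m \text{ and all } \mathcal R'\subseteq\mathcal R_m \text{ with } |\mathcal R'|=\rho_m-X-T\Big\},$$ and the maximum is attained. -/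

import Mathlib

open MeasureTheory ProbabilityTheory Filter Topology
open scoped ENNReal

namespace GXSTPIR

/-- Indices `(m, k)` of the messages: `M` message sets, the `m`-th one with `K m` messages. -/
abbrev MsgIdx {M : ℕ} (K : Fin M → ℕ) : Type := Σ m : Fin M, Fin (K m)

/-- Independence of two discrete random variables (both codomains carry the discrete
σ-algebra), i.e. vanishing mutual information. -/
def DiscreteIndep {Ω α β : Type} [MeasurableSpace Ω] (μ : Measure Ω) (f : Ω → α) (g : Ω → β) : Prop :=
  @IndepFun _ _ _ _ ⊤ ⊤ f g μ

/-- Mutual independence of finitely many discrete random variables, i.e. the joint entropy is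
the sum of the entropies. -/
def MutuallyIndep {Ω ι : Type} {α : ι → Type} [MeasurableSpace Ω] (μ : Measure Ω)
    (f : (i : ι) → Ω → α i) : Prop :=
  iIndepFun (m := fun _ => ⊤) f μ

/-- `f` is almost surely a function of `g`, i.e. the conditional entropy of `f` given `g` is `0`. -/
def DeterminedBy {Ω α β : Type} [MeasurableSpace Ω] (μ : Measure Ω) (f : Ω → α) (g : Ω → β) :
    Prop :=
  ∃ φ : β → α, ∀ᵐ ω ∂μ, f ω = φ (g ω)

/-- The random variable `f` is uniformly distributed on the finite set `α`. -/
def IsUniform {Ω α : Type} [MeasurableSpace Ω] [Fintype α] (μ : Measure Ω) (f : Ω → α) : Prop :=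
  ∀ a : α, μ {ω | f ω = a} = (Fintype.card α : ℝ≥0∞)⁻¹

/-- The random variables of an information retrieval scheme with graph based replicated storage:
`N` servers, `M` message sets, storage pattern `R` (the messages of the `m`-th set may only be
shared among the servers in `R m`), `K m` messages in the `m`-th set, each consisting of `L`
symbols from the alphabet `F`. No constraint other than the storage pattern and the dependence
of the answers on query and storage is imposed here; see `Scheme.Feasible`. -/
structure Scheme (F : Type) {N M : ℕ} (R : Fin M → Finset (Fin N)) (K : Fin M → ℕ) (L : ℕ) where
  /-- the underlying probability space -/
  Ω : Type
  [measurableSpace : MeasurableSpace Ω]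
  μ : Measure Ω
  [isProbabilityMeasure : IsProbabilityMeasure μ]
  /-- a common finite alphabet for the secret shares of the messages -/
  Share : Type
  [finite_share : Finite Share]
  /-- a common finite alphabet for the queries -/
  Query : Type
  [finite_query : Finite Query]
  /-- the messages -/
  message : Ω → MsgIdx K → Fin L → F
  /-- `share ω i n` is the share of message `i` stored at the server `n ∈ R i.1` -/
  share : Ω → (i : MsgIdx K) → R i.1 → Share
  /-- the index of the message that the user wants -/
  desired : Ω → MsgIdx K
  /-- `query ω n` is the query sent to server `n` -/
  query : Ω → Fin N → Query
  /-- the answer string of server `n`, as a function of its query and its storage -/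
  answerFun : (n : Fin N) → Query → ({i : MsgIdx K // n ∈ R i.1} → Share) → List F
  measurable_message : Measurable[_, ⊤] message
  measurable_share : Measurable[_, ⊤] share
  measurable_desired : Measurable[_, ⊤] desired
  measurable_query : Measurable[_, ⊤] query

namespace Scheme

attribute [instance] Scheme.measurableSpace Scheme.isProbabilityMeasure
  Scheme.finite_share Scheme.finite_query

variable {F : Type} {N M : ℕ} {R : Fin M → Finset (Fin N)} {K : Fin M → ℕ} {L : ℕ}

/-- The storage of server `n`: its shares of the messages `i` with `n ∈ R i.1`. -/
def storage (s : Scheme F R K L) (ω : s.Ω) (n : Fin N) : {i : MsgIdx K // n ∈ R i.1} → s.Share :=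
  fun i => s.share ω i.1 ⟨n, i.2⟩

/-- The answer string returned by server `n`. -/
def answer (s : Scheme F R K L) (ω : s.Ω) (n : Fin N) : List F :=
  s.answerFun n (s.query ω n) (s.storage ω n)

/-- The defining constraints of an `X`-secure `T`-private information retrieval scheme. -/
structure Feasible [Fintype F] (s : Scheme F R K L) (X T : ℕ) : Prop where
  /-- the symbols of all messages are i.i.d. uniform -/
  message_uniform : IsUniform s.μ s.message
  /-- every message can be recovered from all of its shares -/
  recoverable : ∀ i, DeterminedBy s.μ (fun ω => s.message ω i) (fun ω => s.share ω i)
  /-- the shares of different messages are generated independently -/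
  share_indep : MutuallyIndep s.μ (fun i ω => s.share ω i)
  /-- `X`-security: any `X` servers together learn nothing about the messages -/
  secure : ∀ C : Finset (Fin N), C.card = X →
    DiscreteIndep s.μ (fun ω (n : C) => s.storage ω n) s.message
  /-- the index of the desired message is uniform -/
  desired_uniform : IsUniform s.μ s.desired
  /-- the user has no prior knowledge of the messages and the storage -/
  no_prior : DiscreteIndep s.μ s.storage (fun ω => (s.desired ω, s.query ω))
  /-- `T`-privacy: any `T` servers together learn nothing about the desired index -/
  isPrivate : ∀ C : Finset (Fin N), C.card = T →
    DiscreteIndep s.μ (fun ω (n : C) => s.query ω n) s.desired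
  /-- answer strings are self-delimiting: for every query that a server may receive, the strings
  with which it may answer form a prefix-free set (strings of a fixed length, for instance), so
  that the length of a string carries no information beyond its symbols -/
  prefix_free : ∀ (n : Fin N) (q : s.Query) (a b : List F),
    s.μ {ω | s.query ω n = q ∧ s.answer ω n = a} ≠ 0 →
    s.μ {ω | s.query ω n = q ∧ s.answer ω n = b} ≠ 0 → a <+: b → a = b
  /-- correctness: the user recovers the desired message -/
  correct : DeterminedBy s.μ (fun ω => s.message ω (s.desired ω))
    (fun ω => (s.answer ω, s.query ω, s.desired ω))

/-- The expected total number of symbols downloaded from all servers. -/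
noncomputable def download (s : Scheme F R K L) : ℝ≥0∞ :=
  ∫⁻ ω, ∑ n, ((s.answer ω n).length : ℝ≥0∞) ∂s.μ

/-- The rate: desired symbols retrieved per expected downloaded symbol. -/
noncomputable def rate (s : Scheme F R K L) : ℝ≥0∞ := (L : ℝ≥0∞) / s.download

end Scheme

/-- The capacity for given numbers `K m` of messages: the supremum of the rates of all feasible
schemes, over all message lengths `L`. -/
noncomputable def capacity (F : Type) [Fintype F] {N M : ℕ} (R : Fin M → Finset (Fin N))
    (X T : ℕ) (K : Fin M → ℕ) : ℝ≥0∞ :=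
  ⨆ (L : ℕ) (_ : 0 < L) (s : Scheme F R K L) (_ : s.Feasible X T), s.rate

/-- The feasible region of the linear program: nonnegative `D` with `∑ n ∈ R', D n ≥ 1` for all
`m` and all `R' ⊆ R m` with `|R'| = |R m| - X - T`. -/
def feasibleRegion {N M : ℕ} (R : Fin M → Finset (Fin N)) (X T : ℕ) : Set (Fin N → ℝ) :=
  {D | (∀ n, 0 ≤ D n) ∧
    ∀ m, ∀ R' ⊆ R m, R'.card + X + T = (R m).card → 1 ≤ ∑ n ∈ R', D n}

end GXSTPIR

/-! Converse. Let `C` and `C'` consist of `X` and `T` servers. Condition on the storage of `C`, on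
all shares of the messages outside set `m`, and on all shares of the first `t` messages of set `m`.
By security and independence of the messages, the next message is still uniform, and it must be
recovered from the answers of `R m \ (C ∪ C')` and of `C'`. Hence its entropy is at most the entropy
of the former answers plus the drop in the equivocation of the latter when that message is revealed
(`Feasible.core_bound`). By privacy the law of the queries to `C'` does not depend on the desired
index, so after averaging these drops telescope over `t` (`Feasible.converse`). With Kraft's
inequality (`entropy_le_expected_length`), the servers of `R m` outside `C ∪ C'` return at least `L`
symbols on average, up to a `1 / K m` fraction of the whole download. As `C ∪ C'` can cover any `X +
T` servers, the normalised expected lengths satisfy the linear program up to a vanishing error; if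
`|R m| ≤ X + T`, nothing remains outside and the rate is at most `1 / K m`.

Achievability. A real solution is scaled and rounded up to integers `d n`
(`ofReal_inv_le_of_forall_nat`). Server `n` is split into `d n` virtual servers, of which message
set `m` uses at most `δ m`. In a cross-subspace alignment code, shares and queries at the point `α`
are masked by `(f - α)` times random polynomials of degree below `X * δ m` and `T * δ m`. Their
product over `f - α` is a Cauchy term carrying the desired symbol plus a polynomial of degree below
`(X + T) * δ m`, which a combination with nodal weights annihilates (`decode_identity`). This takes
`L + (X + T) * δ m` active points; a suitable `δ m` exists exactly because of the constraints of the
linear program (`exists_threshold`). Every virtual server returns one field element, so the rate is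
`L / ∑ d n` for all positive `K`. -/

namespace GXSTPIR

/-! ### Shannon entropy on a finite weighted set. -/

section Entropy

variable {S : Type} [Fintype S] {α β γ : Type}

open scoped Classical in
/-- The `p`-weight of the fibre of `f` through `s`. -/
noncomputable def fiberWeight (p : S → ℝ) (f : S → α) (s : S) : ℝ :=
  ∑ t, if f t = f s then p t else 0

/-- The Shannon entropy of `f` under the weight `p`. -/
noncomputable def entropy (p : S → ℝ) (f : S → α) : ℝ :=
  ∑ s, p s * -Real.log (fiberWeight p f s)

variable {p : S → ℝ}

lemma fiberWeight_eq [DecidableEq α] (f : S → α) (s : S) :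
    fiberWeight p f s = ∑ t, if f t = f s then p t else 0 := by
  unfold fiberWeight
  congr! 2

lemma le_fiberWeight (hp : ∀ s, 0 ≤ p s) (f : S → α) (s : S) : p s ≤ fiberWeight p f s := by
  classical
  have := Finset.single_le_sum (f := fun t => if f t = f s then p t else 0)
    (fun t _ => by split_ifs <;> simp [hp]) (Finset.mem_univ s)
  simpa [fiberWeight] using this

lemma fiberWeight_nonneg (hp : ∀ s, 0 ≤ p s) (f : S → α) (s : S) : 0 ≤ fiberWeight p f s :=
  (hp s).trans (le_fiberWeight hp f s)

lemma fiberWeight_pos (hp : ∀ s, 0 ≤ p s) (f : S → α) {s : S} (hs : p s ≠ 0) :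
    0 < fiberWeight p f s :=
  ((hp s).lt_of_ne' hs).trans_le (le_fiberWeight hp f s)

lemma fiberWeight_le_one (hp : ∀ s, 0 ≤ p s) (h1 : ∑ s, p s = 1) (f : S → α) (s : S) :
    fiberWeight p f s ≤ 1 := by
  rw [← h1]
  exact Finset.sum_le_sum fun t _ => by split_ifs <;> simp [hp]

lemma fiberWeight_congr (f : S → α) {s t : S} (h : f s = f t) :
    fiberWeight p f s = fiberWeight p f t := by
  unfold fiberWeight
  rw [h]

lemma entropy_nonneg (hp : ∀ s, 0 ≤ p s) (h1 : ∑ s, p s = 1) (f : S → α) : 0 ≤ entropy p f :=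
  Finset.sum_nonneg fun s _ => mul_nonneg (hp s) (neg_nonneg.2
    (Real.log_nonpos (fiberWeight_nonneg hp f s) (fiberWeight_le_one hp h1 f s)))

/-- A variable that is determined by another one has smaller entropy. -/
lemma entropy_le_of_determined (hp : ∀ s, 0 ≤ p s) {f : S → α} {g : S → β}
    (h : ∀ s t, p s ≠ 0 → p t ≠ 0 → g s = g t → f s = f t) : entropy p f ≤ entropy p g := by
  classical
  refine Finset.sum_le_sum fun s _ => ?_
  rcases eq_or_ne (p s) 0 with hs | hs
  · simp [hs]
  refine mul_le_mul_of_nonneg_left (neg_le_neg (Real.log_le_log (fiberWeight_pos hp g hs) ?_)) (hp s)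
  refine Finset.sum_le_sum fun t _ => ?_
  rcases eq_or_ne (p t) 0 with ht | ht
  · simp [ht]
  by_cases hg : g t = g s
  · simp [hg, h t s ht hs hg]
  · rw [if_neg hg]; split_ifs <;> simp [hp]

/-- Submodularity of entropy. -/
lemma entropy_submodular (hp : ∀ s, 0 ≤ p s) (h1 : ∑ s, p s = 1) (f : S → α) (g : S → β)
    (h : S → γ) :
    entropy p (fun s => (f s, g s, h s)) + entropy p h ≤
      entropy p (fun s => (f s, h s)) + entropy p (fun s => (g s, h s)) := by
  classical
  set A := fiberWeight p (fun s => (f s, g s, h s)) with hA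
  set B := fiberWeight p h with hB
  set C := fiberWeight p (fun s => (f s, h s)) with hC
  set D := fiberWeight p (fun s => (g s, h s)) with hD
  -- With `log x ≤ x - 1`, this bound on the mean of `P(f,h) P(g,h) / (P(f,g,h) P(h))` makes the
  -- conditional mutual information nonnegative. The product `C s * D s` is expanded over pairs `t`,
  -- `u` that share `(f, h)`, respectively `(g, h)`, with `s`.
  have key : ∑ s, p s * (C s * D s / (A s * B s)) ≤ 1 := by
    have e1 : ∀ s, p s * (C s * D s / (A s * B s)) = ∑ t, ∑ u, p t * p u *
        (if f t = f s ∧ h t = h s ∧ g u = g s ∧ h u = h s then p s / (A s * B s) else 0) := by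
      intro s
      have : C s * D s = ∑ t, ∑ u, p t * p u *
          (if f t = f s ∧ h t = h s ∧ g u = g s ∧ h u = h s then 1 else 0) := by
        rw [hC, hD, fiberWeight_eq, fiberWeight_eq, Finset.sum_mul_sum]
        refine Finset.sum_congr rfl fun t _ => Finset.sum_congr rfl fun u _ => ?_
        simp only [Prod.mk.injEq]
        by_cases h1 : f t = f s ∧ h t = h s <;> by_cases h2 : g u = g s ∧ h u = h s
        · simp [h1, h2]
        all_goals simp only [h1, h2, if_false, mul_zero, zero_mul]
        all_goals rw [if_neg (by tauto), mul_zero]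
      rw [mul_div_assoc', mul_comm (p s), ← mul_div_assoc', this, Finset.sum_mul]
      refine Finset.sum_congr rfl fun t _ => ?_
      rw [Finset.sum_mul]
      refine Finset.sum_congr rfl fun u _ => ?_
      split_ifs <;> simp
    simp_rw [e1]
    rw [Finset.sum_comm]
    -- For fixed `t` and `u` the admissible `s` form one fibre of `(f, g, h)` or none; its total
    -- weight cancels `A` and leaves at most `1 / B t`.
    have e2 : ∀ t, ∑ s, ∑ u, p t * p u *
        (if f t = f s ∧ h t = h s ∧ g u = g s ∧ h u = h s then p s / (A s * B s) else 0)
        ≤ ∑ u, p t * p u * (if h u = h t then 1 / B t else 0) := by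
      intro t
      rw [Finset.sum_comm]
      refine Finset.sum_le_sum fun u _ => ?_
      rw [← Finset.mul_sum]
      refine mul_le_mul_of_nonneg_left ?_ (mul_nonneg (hp t) (hp u))
      by_cases hut : h u = h t
      · rw [if_pos hut]
        by_cases hex : ∃ s₀, f t = f s₀ ∧ h t = h s₀ ∧ g u = g s₀ ∧ h u = h s₀
        · obtain ⟨s₀, a1, a2, a3, a4⟩ := hex
          have : ∀ s, (if f t = f s ∧ h t = h s ∧ g u = g s ∧ h u = h s then
              p s / (A s * B s) else 0) =
              (if (f s, g s, h s) = (f s₀, g s₀, h s₀) then p s else 0) * (1 / (A s₀ * B t)) := by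
            intro s
            by_cases hs : f t = f s ∧ h t = h s ∧ g u = g s ∧ h u = h s
            · have hs' : (f s, g s, h s) = (f s₀, g s₀, h s₀) := by
                rw [← a1, ← a2, ← a3, ← hs.1, ← hs.2.1, ← hs.2.2.1]
              rw [if_pos hs, if_pos hs', hA, hB,
                fiberWeight_congr (fun s => (f s, g s, h s)) hs', fiberWeight_congr h hs.2.1]
              ring
            · rw [if_neg hs, if_neg, zero_mul]
              intro hs'
              simp only [Prod.mk.injEq] at hs'
              exact hs ⟨a1.trans hs'.1.symm, a2.trans hs'.2.2.symm, a3.trans hs'.2.1.symm,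
                a4.trans hs'.2.2.symm⟩
          simp_rw [this]
          rw [← Finset.sum_mul]
          have : ∑ s, (if (f s, g s, h s) = (f s₀, g s₀, h s₀) then p s else 0) = A s₀ :=
            (fiberWeight_eq _ _).symm
          rw [this]
          have hA0 : 0 ≤ A s₀ := fiberWeight_nonneg hp _ _
          have hB0 : 0 ≤ B t := fiberWeight_nonneg hp _ _
          rcases hA0.eq_or_lt with h0 | h0
          · rw [← h0]; simp [hB0]
          · rw [mul_one_div, ← div_div, div_self h0.ne']
        · refine (Finset.sum_nonpos fun s _ => ?_).trans (one_div_nonneg.2 (fiberWeight_nonneg hp _ _))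
          rw [if_neg fun hs => hex ⟨s, hs⟩]
      · rw [if_neg hut]
        refine Finset.sum_nonpos fun s _ => ?_
        rw [if_neg fun hs => hut (hs.2.2.2.trans hs.2.1.symm)]
    refine (Finset.sum_le_sum fun t _ => e2 t).trans (le_of_le_of_eq ?_ h1)
    refine Finset.sum_le_sum fun t _ => ?_
    have : ∑ u, p t * p u * (if h u = h t then 1 / B t else 0) = p t * (B t * (1 / B t)) := by
      have hBt : B t = ∑ u, if h u = h t then p u else 0 := fiberWeight_eq _ _
      generalize 1 / B t = b
      rw [hBt, Finset.sum_mul, Finset.mul_sum]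
      refine Finset.sum_congr rfl fun u _ => ?_
      split_ifs <;> ring
    rw [this]
    rcases eq_or_ne (B t) 0 with h0 | h0
    · simp [h0, hp]
    · rw [mul_one_div_cancel h0, mul_one]
  have main : ∑ s, p s * (Real.log (C s) + Real.log (D s) - Real.log (A s) - Real.log (B s)) ≤
      ∑ s, (p s * (C s * D s / (A s * B s)) - p s) := by
    refine Finset.sum_le_sum fun s _ => ?_
    rcases eq_or_ne (p s) 0 with hs | hs
    · simp [hs]
    have a1 := fiberWeight_pos hp (fun s => (f s, g s, h s)) hs
    have a2 := fiberWeight_pos hp h hs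
    have a3 := fiberWeight_pos hp (fun s => (f s, h s)) hs
    have a4 := fiberWeight_pos hp (fun s => (g s, h s)) hs
    have := Real.log_le_sub_one_of_pos (show 0 < C s * D s / (A s * B s) by positivity)
    rw [Real.log_div (by positivity) (by positivity), Real.log_mul (by positivity) (by positivity),
      Real.log_mul (by positivity) (by positivity)] at this
    nlinarith [mul_le_mul_of_nonneg_left this (hp s)]
  rw [Finset.sum_sub_distrib, h1] at main
  have : entropy p (fun s => (f s, g s, h s)) + entropy p h -
      (entropy p (fun s => (f s, h s)) + entropy p (fun s => (g s, h s))) =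
      ∑ s, p s * (Real.log (C s) + Real.log (D s) - Real.log (A s) - Real.log (B s)) := by
    simp only [entropy, ← Finset.sum_add_distrib, ← Finset.sum_sub_distrib]
    refine Finset.sum_congr rfl fun s _ => ?_
    rw [← hA, ← hB, ← hC, ← hD]; ring
  linarith

lemma entropy_const (h1 : ∑ s, p s = 1) (c : α) : entropy p (fun _ : S => c) = 0 := by
  simp [entropy, fiberWeight, h1]

lemma entropy_prod_le (hp : ∀ s, 0 ≤ p s) (h1 : ∑ s, p s = 1) (f : S → α) (g : S → β) :
    entropy p (fun s => (f s, g s)) ≤ entropy p f + entropy p g := by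
  -- Subadditivity is submodularity with a constant as the condition.
  have h := entropy_submodular hp h1 f g (fun _ => ())
  rw [entropy_const h1] at h
  have a1 : entropy p (fun s => (f s, g s)) ≤ entropy p (fun s => (f s, g s, ())) :=
    entropy_le_of_determined hp (by simp)
  have a2 : entropy p (fun s => (f s, ())) ≤ entropy p f :=
    entropy_le_of_determined hp (by simp)
  have a3 : entropy p (fun s => (g s, ())) ≤ entropy p g :=
    entropy_le_of_determined hp (by simp)
  linarith

lemma entropy_prod_of_indep (hp : ∀ s, 0 ≤ p s) {f : S → α} {g : S → β}
    (h : ∀ s, p s ≠ 0 →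
      fiberWeight p (fun t => (f t, g t)) s = fiberWeight p f s * fiberWeight p g s) :
    entropy p (fun s => (f s, g s)) = entropy p f + entropy p g := by
  rw [entropy, entropy, entropy, ← Finset.sum_add_distrib]
  refine Finset.sum_congr rfl fun s _ => ?_
  rcases eq_or_ne (p s) 0 with hs | hs
  · simp [hs]
  rw [h s hs, Real.log_mul (fiberWeight_pos hp f hs).ne' (fiberWeight_pos hp g hs).ne']
  ring

open scoped Classical in
/-- The joint variable of the `A i` with `i ∈ B`. -/
noncomputable def jointOn {ι : Type} (B : Finset ι) (A : ι → S → α) (s : S) (i : ι) : Option α :=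
  if i ∈ B then some (A i s) else none

/-- Padding by `none` gives one codomain for all `B`; entropy only sees which sample points are
identified. -/
lemma jointOn_eq_iff {S ι : Type} {B : Finset ι} {A : ι → S → α} {s t : S} :
    jointOn B A s = jointOn B A t ↔ ∀ i ∈ B, A i s = A i t := by
  classical
  constructor
  · intro h i hi
    simpa [jointOn, hi] using congrFun h i
  · intro h
    funext i
    by_cases hi : i ∈ B <;> simp [jointOn, hi]
    exact h i hi

lemma entropy_jointOn_le (hp : ∀ s, 0 ≤ p s) (h1 : ∑ s, p s = 1) {ι : Type} (B : Finset ι)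
    (A : ι → S → α) : entropy p (jointOn B A) ≤ ∑ i ∈ B, entropy p (A i) := by
  classical
  induction B using Finset.induction_on with
  | empty =>
    rw [Finset.sum_empty, ← entropy_const (p := p) h1 ()]
    exact entropy_le_of_determined hp fun s t _ _ _ => jointOn_eq_iff.2 (by simp)
  | insert i B hi ih =>
    rw [Finset.sum_insert hi]
    refine (entropy_le_of_determined hp (g := fun s => (A i s, jointOn B A s)) ?_).trans
      ((entropy_prod_le hp h1 _ _).trans (by linarith))
    intro s t _ _ h
    simp only [Prod.mk.injEq, jointOn_eq_iff] at h
    rw [jointOn_eq_iff]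
    intro j hj
    rcases Finset.mem_insert.1 hj with rfl | hj
    · exact h.1
    · exact h.2 j hj

end Entropy

/-! ### Prefix-free codes and Kraft's inequality. -/

section Kraft

variable {F : Type} [Fintype F]

/-- The first words of two factorisations are prefixes of the same string, so one is a prefix of the
other and they agree; then cancel. The empty word could be inserted anywhere, hence its exclusion.
-/
lemma uniquelyDecodable_of_prefixFree {F : Type} {C : Set (List F)} (h0 : [] ∉ C)
    (h : ∀ a ∈ C, ∀ b ∈ C, a <+: b → a = b) : InformationTheory.UniquelyDecodable C := by
  intro l₁
  induction l₁ with
  | nil =>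
    intro l₂ _ h₂ e
    cases l₂ with
    | nil => rfl
    | cons b l₂ =>
      simp only [List.flatten_nil, List.flatten_cons] at e
      have : b = [] := (List.append_eq_nil_iff.1 e.symm).1
      exact absurd (this ▸ h₂ b (by simp)) h0
  | cons a l₁ ih =>
    intro l₂ h₁ h₂ e
    cases l₂ with
    | nil =>
      simp only [List.flatten_nil, List.flatten_cons] at e
      have : a = [] := (List.append_eq_nil_iff.1 e).1
      exact absurd (this ▸ h₁ a (by simp)) h0
    | cons b l₂ =>
      simp only [List.flatten_cons] at e
      have hab : a = b := by
        rcases List.prefix_or_prefix_of_prefix (List.prefix_append a l₁.flatten)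
          (e ▸ List.prefix_append b l₂.flatten) with hh | hh
        · exact h a (h₁ a (by simp)) b (h₂ b (by simp)) hh
        · exact (h b (h₂ b (by simp)) a (h₁ a (by simp)) hh).symm
      subst hab
      rw [ih l₂ (fun w hw => h₁ w (by simp [hw])) (fun w hw => h₂ w (by simp [hw]))
        (List.append_cancel_left e)]

lemma kraft_of_prefixFree [Nonempty F] {C : Finset (List F)}
    (h : ∀ a ∈ C, ∀ b ∈ C, a <+: b → a = b) :
    ∑ w ∈ C, (1 / Fintype.card F : ℝ) ^ w.length ≤ 1 := by
  -- The empty word is a prefix of every word, so a prefix-free code containing it has no other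
  -- word.
  by_cases h0 : [] ∈ C
  · have : C = {[]} := Finset.eq_singleton_iff_unique_mem.2
      ⟨h0, fun w hw => (h [] h0 w hw List.nil_prefix).symm⟩
    simp [this]
  · exact InformationTheory.kraft_mcmillan_inequality
      (uniquelyDecodable_of_prefixFree (by simpa using h0) (by simpa using h))

/-- The entropy of a prefix-free code is at most its expected length. -/
lemma entropy_le_expected_length [Nonempty F] {S : Type} [Fintype S] {p : S → ℝ}
    (hp : ∀ s, 0 ≤ p s) (h1 : ∑ s, p s = 1) (f : S → List F)
    (h : ∀ s t, p s ≠ 0 → p t ≠ 0 → f s <+: f t → f s = f t) :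
    entropy p f ≤ (∑ s, p s * (f s).length) * Real.log (Fintype.card F) := by
  classical
  have hq : (0 : ℝ) < Fintype.card F := by exact_mod_cast Fintype.card_pos
  set r : S → ℝ := fun s => (1 / Fintype.card F : ℝ) ^ (f s).length with hr
  -- Grouped by the value `w` of `f`, the sum is Kraft's sum over the words of positive probability.
  -- Prefix-freeness is known only on the support `U`. Then `log x ≤ x - 1` gives Gibbs' inequality.
  have key : ∑ s, p s * (r s / fiberWeight p f s) ≤ 1 := by
    let U : Finset S := Finset.univ.filter fun s => p s ≠ 0
    have hK := kraft_of_prefixFree (C := U.image f) (by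
      simp only [Finset.mem_image, forall_exists_index, and_imp]
      rintro _ s hs rfl _ t ht rfl
      exact h s t (by simpa [U] using hs) (by simpa [U] using ht))
    refine le_trans ?_ hK
    have : ∑ s, p s * (r s / fiberWeight p f s) = ∑ s ∈ U, p s * (r s / fiberWeight p f s) := by
      refine (Finset.sum_subset (Finset.subset_univ U) fun s _ hs => ?_).symm
      have : p s = 0 := by simpa [U] using hs
      simp [this]
    rw [this, ← Finset.sum_fiberwise_of_maps_to (t := U.image f) (g := f)
      (fun s hs => Finset.mem_image_of_mem f hs)]
    refine Finset.sum_le_sum fun w hw => ?_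
    obtain ⟨s₀, hs₀, rfl⟩ := Finset.mem_image.1 hw
    have hs₀' : p s₀ ≠ 0 := by simpa [U] using hs₀
    have hpos := fiberWeight_pos hp f hs₀'
    have : ∑ s ∈ U with f s = f s₀, p s * (r s / fiberWeight p f s) =
        (∑ s ∈ U with f s = f s₀, p s) * (r s₀ / fiberWeight p f s₀) := by
      rw [Finset.sum_mul]
      refine Finset.sum_congr rfl fun s hs => ?_
      have e := (Finset.mem_filter.1 hs).2
      rw [fiberWeight_congr f e, hr]
      simp only [e]
    rw [this]
    have h2 : ∑ s ∈ U with f s = f s₀, p s ≤ fiberWeight p f s₀ := by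
      rw [fiberWeight_eq, ← Finset.sum_filter]
      refine Finset.sum_le_sum_of_subset_of_nonneg ?_ fun s _ _ => hp s
      intro s hs
      simp only [Finset.mem_filter, Finset.mem_univ, true_and] at hs ⊢
      exact hs.2
    calc _ ≤ fiberWeight p f s₀ * (r s₀ / fiberWeight p f s₀) :=
          mul_le_mul_of_nonneg_right h2 (by positivity)
      _ = r s₀ := by field_simp
  have main : entropy p f - (∑ s, p s * (f s).length) * Real.log (Fintype.card F) ≤
      ∑ s, (p s * (r s / fiberWeight p f s) - p s) := by
    rw [entropy, Finset.sum_mul, ← Finset.sum_sub_distrib]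
    refine Finset.sum_le_sum fun s _ => ?_
    rcases eq_or_ne (p s) 0 with hs | hs
    · simp [hs]
    have hpos := fiberWeight_pos hp f hs
    have := Real.log_le_sub_one_of_pos (show 0 < r s / fiberWeight p f s by positivity)
    rw [Real.log_div (by positivity) (by positivity), hr] at this
    simp only [Real.log_pow, one_div, Real.log_inv] at this
    simp only [hr, one_div]
    nlinarith [mul_le_mul_of_nonneg_left this (hp s)]
  rw [Finset.sum_sub_distrib, h1] at main
  linarith

end Kraft

end GXSTPIR

/-! ### Independence of discrete random variables. -/

namespace GXSTPIR

section Discrete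

variable {Ω α β : Type} [MeasurableSpace Ω] {μ : Measure Ω}

lemma measurableSet_of_discrete {f : Ω → α} (hf : Measurable[_, ⊤] f) (P : α → Prop) :
    MeasurableSet {ω | P (f ω)} :=
  hf (t := {a | P a}) trivial

-- The event `E` lets one expansion serve both the marginal laws and the joint law with the desired
-- index.
open scoped Classical in
lemma measureReal_eq_sum [IsFiniteMeasure μ] [Fintype α] {f : Ω → α} (hf : Measurable[_, ⊤] f)
    {E : Set Ω} (hE : MeasurableSet E) (P : α → Prop) :
    μ.real {ω | ω ∈ E ∧ P (f ω)} = ∑ a, if P a then μ.real {ω | ω ∈ E ∧ f ω = a} else 0 := by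
  rw [← Finset.sum_filter, ← measureReal_biUnion_finset]
  · congr 1
    ext ω
    simp only [Set.mem_ofPred_eq, Finset.mem_filter, Finset.mem_univ, true_and, Set.mem_iUnion]
    constructor
    · exact fun h => ⟨f ω, h.2, h.1, rfl⟩
    · rintro ⟨a, h1, h2, rfl⟩
      exact ⟨h2, h1⟩
  · intro a _ b _ hab
    refine Set.disjoint_left.2 ?_
    rintro ω ⟨_, rfl⟩ ⟨_, h⟩
    exact hab h
  · exact fun a _ => hE.inter (measurableSet_of_discrete hf (· = a))

lemma DiscreteIndep.measureReal {f : Ω → α} {g : Ω → β} (h : DiscreteIndep μ f g)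
    (P : α → Prop) (Q : β → Prop) :
    μ.real {ω | P (f ω) ∧ Q (g ω)} = μ.real {ω | P (f ω)} * μ.real {ω | Q (g ω)} := by
  have := @IndepFun.measure_inter_preimage_eq_mul _ _ _ _ _ _ _ ⊤ ⊤ h {a | P a} {b | Q b}
    trivial trivial
  rw [Measure.real, Measure.real, Measure.real, ← ENNReal.toReal_mul, ← Set.preimage_ofPred_eq,
    ← Set.preimage_ofPred_eq (f := g), ← this]
  rfl

lemma DiscreteIndep.comp {α' β' : Type} {f : Ω → α} {g : Ω → β} (h : DiscreteIndep μ f g)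
    (φ : α → α') (ψ : β → β') : DiscreteIndep μ (fun ω => φ (f ω)) (fun ω => ψ (g ω)) := by
  let _ : MeasurableSpace α := ⊤
  let _ : MeasurableSpace β := ⊤
  let _ : MeasurableSpace α' := ⊤
  let _ : MeasurableSpace β' := ⊤
  exact IndepFun.comp (φ := φ) (ψ := ψ) h measurable_from_top measurable_from_top

lemma DiscreteIndep.congr {f f' : Ω → α} {g g' : Ω → β} (h : DiscreteIndep μ f g)
    (hf : f =ᵐ[μ] f') (hg : g =ᵐ[μ] g') : DiscreteIndep μ f' g' := by
  let _ : MeasurableSpace α := ⊤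
  let _ : MeasurableSpace β := ⊤
  exact IndepFun.congr h hf hg

lemma DiscreteIndep.symm {f : Ω → α} {g : Ω → β} (h : DiscreteIndep μ f g) :
    DiscreteIndep μ g f := by
  let _ : MeasurableSpace α := ⊤
  let _ : MeasurableSpace β := ⊤
  exact IndepFun.symm h

/-- A summand of a mutually independent family is independent of the rest of the family. -/
lemma MutuallyIndep.discreteIndep_ne {ι : Type} [Fintype ι] {γ : ι → Type} [∀ i, Finite (γ i)]
    {f : (i : ι) → Ω → γ i} (h : MutuallyIndep μ f) (hf : ∀ i, Measurable[_, ⊤] (f i)) (i : ι) :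
    DiscreteIndep μ (f i) (fun ω (j : {j // j ≠ i}) => f j ω) := by
  classical
  let _ : ∀ j, MeasurableSpace (γ j) := fun _ => ⊤
  let _ : MeasurableSpace ((j : {j // j ≠ i}) → γ j) := ⊤
  have := iIndepFun.indepFun_finset {i} (Finset.univ.erase i) (by simp) h hf
  exact IndepFun.comp (φ := fun v => v ⟨i, by simp⟩)
    (ψ := fun v (j : {j // j ≠ i}) => v ⟨j.1, by simpa using j.2⟩) this
    .of_discrete .of_discrete

end Discrete

end GXSTPIR

/-! ### Laws of the shares, queries and messages of a scheme. -/

namespace GXSTPIR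

namespace Scheme

variable {F : Type} {N M : ℕ} {R : Fin M → Finset (Fin N)} {K : Fin M → ℕ} {L : ℕ}

/-- All shares of all messages. -/
abbrev Shares (s : Scheme F R K L) : Type := (i : MsgIdx K) → R i.1 → s.Share

noncomputable instance (s : Scheme F R K L) : Fintype s.Shares := Fintype.ofFinite _

noncomputable instance (s : Scheme F R K L) : Fintype s.Query := Fintype.ofFinite _

/-- The distribution of the shares. -/
noncomputable def shareWeight (s : Scheme F R K L) (σ : s.Shares) : ℝ :=
  s.μ.real {ω | s.share ω = σ}

/-- The joint distribution of the desired index and the queries. -/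
noncomputable def jointQueryWeight (s : Scheme F R K L) (i : MsgIdx K) (q : Fin N → s.Query) : ℝ :=
  s.μ.real {ω | s.desired ω = i ∧ s.query ω = q}

/-- The distribution of the queries. -/
noncomputable def queryWeight (s : Scheme F R K L) (q : Fin N → s.Query) : ℝ :=
  s.μ.real {ω | s.query ω = q}

/-- The answer of server `n`, for given queries and shares. -/
def answerOf (s : Scheme F R K L) (q : Fin N → s.Query) (n : Fin N) (σ : s.Shares) : List F :=
  s.answerFun n (q n) fun i => σ i.1 ⟨n, i.2⟩

variable (s : Scheme F R K L)

lemma shareWeight_nonneg (σ : s.Shares) : 0 ≤ s.shareWeight σ := measureReal_nonneg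

lemma queryWeight_nonneg (q : Fin N → s.Query) : 0 ≤ s.queryWeight q := measureReal_nonneg

lemma jointQueryWeight_nonneg (i : MsgIdx K) (q : Fin N → s.Query) :
    0 ≤ s.jointQueryWeight i q := measureReal_nonneg

lemma fiberWeight_shareWeight {α : Type} (f : s.Shares → α) (σ : s.Shares) :
    fiberWeight s.shareWeight f σ = s.μ.real {ω | f (s.share ω) = f σ} := by
  classical
  have := measureReal_eq_sum (μ := s.μ) s.measurable_share MeasurableSet.univ (fun τ => f τ = f σ)
  simp only [Set.mem_univ, true_and] at this
  rw [this, fiberWeight_eq]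
  rfl

lemma sum_shareWeight : ∑ σ, s.shareWeight σ = 1 := by
  have := measureReal_eq_sum (μ := s.μ) s.measurable_share MeasurableSet.univ (fun _ => True)
  simp only [Set.mem_univ, true_and, if_true] at this
  have h1 : s.μ.real {ω | True} = 1 := by simp [Measure.real]
  rw [h1] at this
  exact this.symm

/-- The rearrangement of the shares by servers. -/
def toStorage (σ : s.Shares) (n : Fin N) (i : {i : MsgIdx K // n ∈ R i.1}) : s.Share :=
  σ i.1 ⟨n, i.2⟩

lemma toStorage_injective : Function.Injective s.toStorage := by
  intro σ τ h
  funext i n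
  exact congrFun (congrFun h n.1) ⟨i, n.2⟩

lemma storage_eq (ω : s.Ω) : s.storage ω = s.toStorage (s.share ω) := rfl

variable {s} [Fintype F] {X T : ℕ}

/-- The storage is an injective rearrangement of the shares, so a left inverse carries `no_prior`
over to them. -/
lemma Feasible.share_indep_query (h : s.Feasible X T) :
    DiscreteIndep s.μ s.share (fun ω => (s.desired ω, s.query ω)) := by
  rcases isEmpty_or_nonempty s.Shares with he | he
  · have : IsEmpty s.Ω := ⟨fun ω => he.false (s.share ω)⟩
    have h1 : s.μ Set.univ = 1 := measure_univ
    simp [Set.univ_eq_empty_iff.2 this] at h1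
  · have := h.no_prior.comp (Function.invFun s.toStorage) id
    simpa only [storage_eq, Function.leftInverse_invFun s.toStorage_injective _, id] using this

lemma Feasible.joint_weight (h : s.Feasible X T) (σ : s.Shares) (i : MsgIdx K)
    (q : Fin N → s.Query) :
    s.μ.real {ω | s.share ω = σ ∧ s.desired ω = i ∧ s.query ω = q} =
      s.shareWeight σ * s.jointQueryWeight i q := by
  exact h.share_indep_query.measureReal (· = σ) (fun p => p.1 = i ∧ p.2 = q)

lemma Feasible.share_query_weight (h : s.Feasible X T) (σ : s.Shares) (q : Fin N → s.Query) :
    s.μ.real {ω | s.share ω = σ ∧ s.query ω = q} = s.shareWeight σ * s.queryWeight q :=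
  h.share_indep_query.measureReal (· = σ) (fun p => p.2 = q)

lemma Feasible.sum_jointQueryWeight (h : s.Feasible X T) (i : MsgIdx K) :
    ∑ q, s.jointQueryWeight i q = (Fintype.card (MsgIdx K) : ℝ)⁻¹ := by
  have := measureReal_eq_sum (μ := s.μ) s.measurable_query
    (measurableSet_of_discrete s.measurable_desired (· = i)) (fun _ => True)
  simp only [if_true, and_true, Set.mem_ofPred_eq] at this
  unfold jointQueryWeight
  rw [← this, Measure.real, h.desired_uniform i, ENNReal.toReal_inv, ENNReal.toReal_natCast]

/-- Privacy: the mean of a quantity that depends on the queries of `T` servers only does not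
depend on the desired index. -/
lemma Feasible.sum_jointQueryWeight_mul (h : s.Feasible X T) {C : Finset (Fin N)}
    (hC : C.card = T) (i : MsgIdx K) (φ : (Fin N → s.Query) → ℝ)
    (hφ : ∀ q q', (∀ n ∈ C, q n = q' n) → φ q = φ q') :
    ∑ q, s.jointQueryWeight i q * φ q =
      (Fintype.card (MsgIdx K) : ℝ)⁻¹ * ∑ q, s.queryWeight q * φ q := by
  classical
  let _ : Fintype (C → s.Query) := Fintype.ofFinite _
  let ρ : (Fin N → s.Query) → C → s.Query := fun q n => q n
  obtain ⟨ψ, hψ⟩ : ∃ ψ : (C → s.Query) → ℝ, ∀ q, φ q = ψ (ρ q) := by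
    refine ⟨Function.extend ρ φ 0, fun q => (Function.FactorsThrough.extend_apply ?_ _ q).symm⟩
    intro q q' e
    exact hφ q q' fun n hn => congrFun e ⟨n, hn⟩
  -- Regrouping of the queries by their restriction to `C`, for `E` the event that `i` is desired
  -- and for the whole space; privacy then compares the two sums.
  have gen : ∀ (E : Set s.Ω), MeasurableSet E → ∑ q, s.μ.real {ω | ω ∈ E ∧ s.query ω = q} * φ q =
      ∑ r, s.μ.real {ω | ω ∈ E ∧ ρ (s.query ω) = r} * ψ r := by
    intro E hE
    have : ∀ r, s.μ.real {ω | ω ∈ E ∧ ρ (s.query ω) = r} * ψ r =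
        ∑ q, if ρ q = r then s.μ.real {ω | ω ∈ E ∧ s.query ω = q} * φ q else 0 := by
      intro r
      rw [measureReal_eq_sum (μ := s.μ) s.measurable_query hE (fun q => ρ q = r), Finset.sum_mul]
      refine Finset.sum_congr rfl fun q _ => ?_
      split_ifs with hq
      · rw [hψ, hq]
      · simp
    simp_rw [this]
    rw [Finset.sum_comm]
    simp
  have g1 := gen {ω | s.desired ω = i} (measurableSet_of_discrete s.measurable_desired (· = i))
  have g2 := gen Set.univ MeasurableSet.univ
  simp only [Set.mem_univ, true_and, Set.mem_ofPred_eq] at g1 g2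
  unfold jointQueryWeight queryWeight
  rw [g1, g2, Finset.mul_sum]
  refine Finset.sum_congr rfl fun r _ => ?_
  have := (h.isPrivate C hC).measureReal (· = r) (· = i)
  have hd : s.μ.real {ω | s.desired ω = i} = (Fintype.card (MsgIdx K) : ℝ)⁻¹ := by
    rw [Measure.real, h.desired_uniform i, ENNReal.toReal_inv, ENNReal.toReal_natCast]
  rw [hd] at this
  have e : {ω | s.desired ω = i ∧ ρ (s.query ω) = r} =
    {ω | (fun n : C => s.query ω n) = r ∧ s.desired ω = i} := by
    ext ω; exact and_comm
  rw [e, this]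
  ring

/-- A family of decoders of the messages from their shares. -/
lemma Feasible.exists_decoder (h : s.Feasible X T) :
    ∃ ψ : (i : MsgIdx K) → (R i.1 → s.Share) → Fin L → F,
      ∀ i, ∀ᵐ ω ∂s.μ, s.message ω i = ψ i (s.share ω i) :=
  ⟨fun i => (h.recoverable i).choose, fun i => (h.recoverable i).choose_spec⟩

/-- Splitting off coordinate `i` counts the message families with prescribed `i`-th message. -/
lemma Feasible.measureReal_message (h : s.Feasible X T) (i : MsgIdx K) (w : Fin L → F) :
    s.μ.real {ω | s.message ω i = w} = ((Fintype.card F : ℝ) ^ L)⁻¹ := by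
  classical
  have := measureReal_eq_sum (μ := s.μ) s.measurable_message MeasurableSet.univ (fun v => v i = w)
  simp only [Set.mem_univ, true_and] at this
  rw [this]
  have hu : ∀ v, s.μ.real {ω | s.message ω = v} =
      (Fintype.card (MsgIdx K → Fin L → F) : ℝ)⁻¹ := by
    intro v
    rw [Measure.real, h.message_uniform v]; simp
  simp_rw [hu]
  rw [← Finset.sum_filter, Finset.sum_const, nsmul_eq_mul]
  let e := Equiv.piSplitAt i (fun _ : MsgIdx K => Fin L → F)
  have hne : Nonempty ({j // j ≠ i} → Fin L → F) := by
    by_contra hcon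
    have he : IsEmpty (MsgIdx K → Fin L → F) :=
      ⟨fun v => hcon ⟨fun j => v j⟩⟩
    have : IsEmpty s.Ω := ⟨fun ω => he.false (s.message ω)⟩
    have h1 : s.μ Set.univ = 1 := measure_univ
    simp [Set.univ_eq_empty_iff.2 this] at h1
  have c1 : (Finset.univ.filter fun v : MsgIdx K → Fin L → F => v i = w).card =
      Fintype.card ({j // j ≠ i} → Fin L → F) := by
    rw [← Finset.card_univ]
    refine Finset.card_bij' (fun v _ => (e v).2) (fun u _ => e.symm (w, u)) ?_ ?_ ?_ ?_
    · simp
    · intro u _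
      simp [e]
    · intro v hv
      have hv' : v i = w := by simpa using hv
      apply e.injective
      rw [Equiv.apply_symm_apply]
      exact Prod.ext hv'.symm rfl
    · intro u _
      simp
  have c2 : Fintype.card (MsgIdx K → Fin L → F) =
      Fintype.card F ^ L * Fintype.card ({j // j ≠ i} → Fin L → F) := by
    rw [Fintype.card_congr e, Fintype.card_prod, Fintype.card_fun, Fintype.card_fin]
  rw [c1, c2]
  have : (Fintype.card ({j // j ≠ i} → Fin L → F) : ℝ) ≠ 0 := by
    exact_mod_cast Fintype.card_ne_zero
  push_cast at this ⊢
  rw [mul_inv, mul_comm, mul_assoc, inv_mul_cancel₀ (by simpa using this), mul_one]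

end Scheme

end GXSTPIR

/-! ### The converse for fixed queries. -/

namespace GXSTPIR

namespace Scheme

variable {F : Type} {N M : ℕ} {R : Fin M → Finset (Fin N)} {K : Fin M → ℕ} {L : ℕ}
  {s : Scheme F R K L} {X T : ℕ}

open scoped Classical in
/-- All shares of the messages in `B`, together with the shares of the servers in `C`. -/
noncomputable def reveal (s : Scheme F R K L) (B : Set (MsgIdx K)) (C : Finset (Fin N))
    (σ : s.Shares) (i : MsgIdx K) (n : R i.1) : Option s.Share :=
  if i ∈ B ∨ n.1 ∈ C then some (σ i n) else none

lemma reveal_eq_iff {B : Set (MsgIdx K)} {C : Finset (Fin N)} {σ τ : s.Shares} :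
    s.reveal B C σ = s.reveal B C τ ↔ ∀ i n, (i ∈ B ∨ n.1 ∈ C) → σ i n = τ i n := by
  classical
  constructor
  · intro h i n hi
    simpa [reveal, hi] using congrFun (congrFun h i) n
  · intro h
    funext i n
    by_cases hi : i ∈ B ∨ n.1 ∈ C
    · simp only [reveal, hi, if_true, h i n hi]
    · simp only [reveal, hi, if_false]

lemma entropy_prod_of_discreteIndep {α β : Type} {f : s.Shares → α} {g : s.Shares → β}
    (h : DiscreteIndep s.μ (fun ω => f (s.share ω)) (fun ω => g (s.share ω))) :
    entropy s.shareWeight (fun σ => (f σ, g σ)) =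
      entropy s.shareWeight f + entropy s.shareWeight g := by
  refine entropy_prod_of_indep s.shareWeight_nonneg fun σ _ => ?_
  rw [fiberWeight_shareWeight, fiberWeight_shareWeight, fiberWeight_shareWeight,
    ← h.measureReal (· = f σ) (· = g σ)]
  simp only [Prod.mk.injEq]

/-- The equivocation of the answers of the servers in `C'`, given the revealed shares. -/
noncomputable def equivocation (s : Scheme F R K L) (C' : Finset (Fin N)) (B : Set (MsgIdx K))
    (C : Finset (Fin N)) (q : Fin N → s.Query) : ℝ :=
  entropy s.shareWeight (fun σ => (jointOn C' (s.answerOf q) σ, s.reveal B C σ)) -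
    entropy s.shareWeight (s.reveal B C)

lemma equivocation_nonneg (C' : Finset (Fin N)) (B : Set (MsgIdx K)) (C : Finset (Fin N))
    (q : Fin N → s.Query) : 0 ≤ s.equivocation C' B C q :=
  sub_nonneg.2 (entropy_le_of_determined s.shareWeight_nonneg (by simp))

/-- Conditioning reduces entropy, and joint entropy is subadditive. -/
lemma equivocation_le (C' : Finset (Fin N)) (B : Set (MsgIdx K)) (C : Finset (Fin N))
    (q : Fin N → s.Query) :
    s.equivocation C' B C q ≤ ∑ n ∈ C', entropy s.shareWeight (s.answerOf q n) := by
  have a1 := entropy_prod_le s.shareWeight_nonneg s.sum_shareWeight (jointOn C' (s.answerOf q))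
    (s.reveal B C)
  have a2 := entropy_jointOn_le s.shareWeight_nonneg s.sum_shareWeight C' (s.answerOf q)
  unfold equivocation
  linarith

lemma answerOf_congr {q q' : Fin N → s.Query} {n : Fin N} (h : q n = q' n) :
    s.answerOf q n = s.answerOf q' n := by
  funext σ
  simp [answerOf, h]

/-- This makes privacy applicable: for `T` servers in `C'`, the mean equivocation cannot depend on
the desired index. -/
lemma equivocation_congr {C' : Finset (Fin N)} {B : Set (MsgIdx K)} {C : Finset (Fin N)}
    {q q' : Fin N → s.Query} (h : ∀ n ∈ C', q n = q' n) :
    s.equivocation C' B C q = s.equivocation C' B C q' := by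
  classical
  have : jointOn C' (s.answerOf q) = jointOn C' (s.answerOf q') := by
    funext σ n
    by_cases hn : n ∈ C' <;> simp [jointOn, hn]
    rw [answerOf_congr (h n hn)]
  rw [equivocation, equivocation, this]

variable [Fintype F]

/-- By security and by the independence of the messages, a message is independent of the shares
of all other messages and of the shares of `X` servers. -/
lemma Feasible.entropy_message_reveal (h : s.Feasible X T)
    {ψ : (i : MsgIdx K) → (R i.1 → s.Share) → Fin L → F}
    (hψ : ∀ i, ∀ᵐ ω ∂s.μ, s.message ω i = ψ i (s.share ω i))
    {B : Set (MsgIdx K)} {C : Finset (Fin N)} (hC : C.card = X) {i : MsgIdx K} (hi : i ∉ B) :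
    entropy s.shareWeight (fun σ => ψ i (σ i)) + entropy s.shareWeight (s.reveal B C) ≤
      entropy s.shareWeight (fun σ => (ψ i (σ i), s.reveal B C σ)) := by
  classical
  have hp := s.shareWeight_nonneg
  have h1 := s.sum_shareWeight
  let W : s.Shares → Fin L → F := fun σ => ψ i (σ i)
  let Y : s.Shares → R i.1 → Option s.Share :=
    fun σ n => if n.1 ∈ C then some (σ i n) else none
  let V : s.Shares → (j : {j // j ≠ i}) → R j.1.1 → s.Share := fun σ j => σ j
  -- Security separates the message `W` from its shares `Y` at `C`; independence of the share
  -- families separates `(W, Y)` from the shares `V` of the other messages.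
  have a1 : entropy s.shareWeight (fun σ => (W σ, Y σ)) =
      entropy s.shareWeight W + entropy s.shareWeight Y := by
    refine entropy_prod_of_discreteIndep ?_
    have := (h.secure C hC).comp
      (fun v (n : R i.1) => if hn : n.1 ∈ C then some (v ⟨n.1, hn⟩ ⟨i, n.2⟩) else none)
      (fun w => w i)
    refine this.symm.congr (hψ i) (Filter.EventuallyEq.of_eq ?_)
    funext ω n
    by_cases hn : n.1 ∈ C <;> simp [Y, hn, storage]
  have a2 : entropy s.shareWeight (fun σ => ((W σ, Y σ), V σ)) =
      entropy s.shareWeight (fun σ => (W σ, Y σ)) + entropy s.shareWeight V := by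
    refine entropy_prod_of_discreteIndep ?_
    have hm : ∀ j, Measurable[_, ⊤] fun ω => s.share ω j := fun j =>
      fun t _ => s.measurable_share (t := {σ | σ j ∈ t}) trivial
    exact (h.share_indep.discreteIndep_ne hm i).comp
      (fun σ => (ψ i σ, fun n : R i.1 => if n.1 ∈ C then some (σ n) else none)) id
  have a3 := entropy_prod_le hp h1 Y V
  -- Since `i ∉ B`, the revealed data are a function of `(Y, V)`; submodularity passes the
  -- independence of `W` from `(Y, V)` to that function.
  have a4 := entropy_submodular hp h1 W (fun σ => (Y σ, V σ)) (s.reveal B C)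
  have a5 : entropy s.shareWeight (fun σ => ((Y σ, V σ), s.reveal B C σ)) ≤
      entropy s.shareWeight (fun σ => (Y σ, V σ)) := by
    refine entropy_le_of_determined hp fun σ τ _ _ e => ?_
    simp only [Prod.mk.injEq] at e ⊢
    refine ⟨e, reveal_eq_iff.2 fun j n hjn => ?_⟩
    by_cases hj : j = i
    · subst hj
      have := congrFun e.1 n
      have hn : n.1 ∈ C := by tauto
      simpa [Y, hn] using this
    · exact congrFun (congrFun e.2 ⟨j, hj⟩) n
  have a6 : entropy s.shareWeight (fun σ => ((W σ, Y σ), V σ)) ≤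
      entropy s.shareWeight (fun σ => (W σ, (Y σ, V σ), s.reveal B C σ)) := by
    refine entropy_le_of_determined hp fun σ τ _ _ e => ?_
    simp only [Prod.mk.injEq] at e ⊢
    tauto
  linarith

lemma Feasible.entropy_message (h : s.Feasible X T)
    {ψ : (i : MsgIdx K) → (R i.1 → s.Share) → Fin L → F}
    (hψ : ∀ i, ∀ᵐ ω ∂s.μ, s.message ω i = ψ i (s.share ω i)) (i : MsgIdx K) :
    entropy s.shareWeight (fun σ => ψ i (σ i)) = L * Real.log (Fintype.card F) := by
  have : ∀ σ, fiberWeight s.shareWeight (fun σ => ψ i (σ i)) σ =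
      ((Fintype.card F : ℝ) ^ L)⁻¹ := by
    intro σ
    rw [fiberWeight_shareWeight, ← h.measureReal_message i (ψ i (σ i))]
    refine measureReal_congr ?_
    filter_upwards [hψ i] with ω hω
    exact propext ⟨fun e => hω.trans e, fun e => hω.symm.trans e⟩
  simp only [entropy, this, ← Finset.sum_mul, s.sum_shareWeight]
  rw [Real.log_inv, Real.log_pow]
  ring

/-- Correctness for fixed queries: the message is determined by the answers. -/
lemma Feasible.decode_of_ne_zero (h : s.Feasible X T)
    {ψ : (i : MsgIdx K) → (R i.1 → s.Share) → Fin L → F}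
    (hψ : ∀ i, ∀ᵐ ω ∂s.μ, s.message ω i = ψ i (s.share ω i)) {i : MsgIdx K}
    {q : Fin N → s.Query} (hq : s.jointQueryWeight i q ≠ 0) {σ τ : s.Shares}
    (hσ : s.shareWeight σ ≠ 0) (hτ : s.shareWeight τ ≠ 0)
    (e : ∀ n, s.answerOf q n σ = s.answerOf q n τ) : ψ i (σ i) = ψ i (τ i) := by
  obtain ⟨φ, hφ⟩ := h.correct
  have key : ∀ σ, s.shareWeight σ ≠ 0 →
      ψ i (σ i) = φ ((fun n => s.answerOf q n σ), q, i) := by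
    intro σ hσ
    -- Shares and queries are independent, so shares and queries of positive weight occur together
    -- with positive probability, and some such sample point satisfies the almost sure decoding
    -- identities.
    have hne : s.μ {ω | s.share ω = σ ∧ s.desired ω = i ∧ s.query ω = q} ≠ 0 := by
      intro h0
      have := h.joint_weight σ i q
      rw [Measure.real, h0] at this
      exact mul_ne_zero hσ hq (by simpa using this.symm)
    have hf : ∃ᵐ ω ∂s.μ, s.share ω = σ ∧ s.desired ω = i ∧ s.query ω = q :=
      frequently_ae_iff.2 hne
    obtain ⟨ω, ⟨e1, e2, e3⟩, e4, e5⟩ := (hf.and_eventually (hφ.and (hψ i))).exists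
    rw [← e1, ← e5, ← e2, ← e3]
    exact e4
  rw [key σ hσ, key τ hτ]
  simp only [e]

/-- The converse bound for fixed queries. -/
lemma Feasible.core_bound (h : s.Feasible X T) {C : Finset (Fin N)} (hC : C.card = X)
    (C' : Finset (Fin N)) {i : MsgIdx K} {B : Set (MsgIdx K)}
    (hB : ∀ j : MsgIdx K, j.1 ≠ i.1 → j ∈ B) (hi : i ∉ B) {q : Fin N → s.Query}
    (hq : s.jointQueryWeight i q ≠ 0) :
    L * Real.log (Fintype.card F) ≤
      ∑ n ∈ R i.1 \ (C ∪ C'), entropy s.shareWeight (s.answerOf q n) +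
        (s.equivocation C' B C q - s.equivocation C' (insert i B) C q) := by
  classical
  obtain ⟨ψ, hψ⟩ := h.exists_decoder
  have hp := s.shareWeight_nonneg
  have h1 := s.sum_shareWeight
  let W : s.Shares → Fin L → F := fun σ => ψ i (σ i)
  let AT := jointOn C' (s.answerOf q)
  let AR := jointOn (R i.1 \ (C ∪ C')) (s.answerOf q)
  let G := s.reveal B C
  let G' := s.reveal (insert i B) C
  have a1 : entropy s.shareWeight W + entropy s.shareWeight G ≤
    entropy s.shareWeight (fun σ => (W σ, G σ)) := h.entropy_message_reveal hψ hC hi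
  have a2 : entropy s.shareWeight W = L * Real.log (Fintype.card F) := h.entropy_message hψ i
  -- All other answers are already functions of `G`: a server outside `R i.1` stores only messages
  -- of other sets, all in `B`, and a remaining server of `R i.1` lies in `C`.
  have det : ∀ σ τ, s.shareWeight σ ≠ 0 → s.shareWeight τ ≠ 0 → AR σ = AR τ → AT σ = AT τ →
      G σ = G τ → W σ = W τ := by
    intro σ τ hσ hτ e1 e2 e3
    refine h.decode_of_ne_zero hψ hq hσ hτ fun n => ?_
    by_cases hn : n ∈ C'
    · exact jointOn_eq_iff.1 e2 n hn
    by_cases hn' : n ∈ R i.1 \ (C ∪ C')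
    · exact jointOn_eq_iff.1 e1 n hn'
    unfold answerOf
    congr 1
    funext j
    refine reveal_eq_iff.1 e3 j.1 ⟨n, j.2⟩ ?_
    by_cases hj : j.1.1 = i.1
    · right
      have := j.2
      rw [hj] at this
      simp only [Finset.mem_sdiff, Finset.mem_union, not_and_or, not_not] at hn'
      tauto
    · exact Or.inl (hB _ hj)
  have a3 : entropy s.shareWeight (fun σ => (AT σ, W σ, G σ)) ≤
      entropy s.shareWeight (fun σ => (AR σ, AT σ, G σ)) := by
    refine entropy_le_of_determined hp fun σ τ hσ hτ e => ?_
    simp only [Prod.mk.injEq] at e ⊢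
    exact ⟨e.2.1, det σ τ hσ hτ e.1 e.2.1 e.2.2, e.2.2⟩
  have a4 := entropy_prod_le hp h1 AR (fun σ => (AT σ, G σ))
  have a5 : entropy s.shareWeight AR ≤ _ := entropy_jointOn_le hp h1 _ _
  -- `G'` determines `(W, G)`, so conditioning on `G'` leaves `AT` no more entropy than conditioning
  -- on `(W, G)`.
  have a6 := entropy_submodular hp h1 AT G' (fun σ => (W σ, G σ))
  have det' : ∀ σ τ, G' σ = G' τ → W σ = W τ ∧ G σ = G τ := by
    intro σ τ e
    refine ⟨?_, reveal_eq_iff.2 fun j n hj => reveal_eq_iff.1 e j n ?_⟩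
    · have : σ i = τ i := funext fun n => reveal_eq_iff.1 e i n (by simp)
      simp [W, this]
    · rcases hj with hj | hj
      · exact Or.inl (Set.mem_insert_of_mem _ hj)
      · exact Or.inr hj
  have a7 : entropy s.shareWeight (fun σ => (G' σ, W σ, G σ)) ≤ entropy s.shareWeight G' := by
    refine entropy_le_of_determined hp fun σ τ _ _ e => ?_
    simp only [Prod.mk.injEq]
    exact ⟨e, det' σ τ e⟩
  have a8 : entropy s.shareWeight (fun σ => (AT σ, G' σ)) ≤
      entropy s.shareWeight (fun σ => (AT σ, G' σ, W σ, G σ)) := by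
    refine entropy_le_of_determined hp fun σ τ _ _ e => ?_
    simp only [Prod.mk.injEq] at e ⊢
    exact ⟨e.1, e.2.1⟩
  have a9 : s.equivocation C' B C q = entropy s.shareWeight (fun σ => (AT σ, G σ)) -
    entropy s.shareWeight G := rfl
  have a10 : s.equivocation C' (insert i B) C q =
    entropy s.shareWeight (fun σ => (AT σ, G' σ)) - entropy s.shareWeight G' := rfl
  rw [a9, a10]
  linarith

end Scheme

end GXSTPIR

/-! ### Averaging over the queries and telescoping over the messages. -/

namespace GXSTPIR

namespace Scheme

variable {F : Type} {N M : ℕ} {R : Fin M → Finset (Fin N)} {K : Fin M → ℕ} {L : ℕ}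
  {s : Scheme F R K L} {X T : ℕ}

/-- The expected number of symbols downloaded from server `n`. -/
noncomputable def expectedLength (s : Scheme F R K L) (n : Fin N) : ℝ :=
  ∑ q, s.queryWeight q * ∑ σ, s.shareWeight σ * (s.answerOf q n σ).length

lemma expectedLength_nonneg (n : Fin N) : 0 ≤ s.expectedLength n :=
  Finset.sum_nonneg fun q _ => mul_nonneg (s.queryWeight_nonneg q)
    (Finset.sum_nonneg fun σ _ => mul_nonneg (s.shareWeight_nonneg σ) (Nat.cast_nonneg _))

/-- The mean over the queries of the entropy of the answer of server `n`. -/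
noncomputable def meanEntropy (s : Scheme F R K L) (n : Fin N) : ℝ :=
  ∑ q, s.queryWeight q * entropy s.shareWeight (s.answerOf q n)

lemma meanEntropy_nonneg (n : Fin N) : 0 ≤ s.meanEntropy n :=
  Finset.sum_nonneg fun q _ => mul_nonneg (s.queryWeight_nonneg q)
    (entropy_nonneg s.shareWeight_nonneg s.sum_shareWeight _)

variable [Fintype F]

/-- The total length is a function of shares and queries, whose joint law is a product of two finite
weights. -/
lemma Feasible.download_eq (h : s.Feasible X T) :
    s.download = ENNReal.ofReal (∑ n, s.expectedLength n) := by
  let Y : s.Ω → s.Shares × (Fin N → s.Query) := fun ω => (s.share ω, s.query ω)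
  let g : s.Shares × (Fin N → s.Query) → ℝ≥0∞ :=
    fun y => ∑ n, ((s.answerOf y.2 n y.1).length : ℝ≥0∞)
  let _ : MeasurableSpace (s.Shares × (Fin N → s.Query)) := ⊤
  have hY : Measurable Y := by
    refine measurable_to_countable' fun y => ?_
    have : Y ⁻¹' {y} = {ω | s.share ω = y.1} ∩ {ω | s.query ω = y.2} := by
      ext ω
      simp [Y, Prod.ext_iff]
    rw [this]
    exact (measurableSet_of_discrete s.measurable_share (· = y.1)).inter
      (measurableSet_of_discrete s.measurable_query (· = y.2))
  have h1 : s.download = ∫⁻ ω, g (Y ω) ∂s.μ := rfl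
  have h2 : ∀ y, s.μ.map Y {y} = ENNReal.ofReal (s.shareWeight y.1 * s.queryWeight y.2) := by
    intro y
    rw [Measure.map_apply hY trivial, ← h.share_query_weight, Measure.real,
      ENNReal.ofReal_toReal (measure_ne_top _ _)]
    congr 1
    ext ω
    simp [Y, Prod.ext_iff]
  rw [h1, ← lintegral_map (f := g) measurable_from_top hY, lintegral_fintype]
  have h3 : ∀ y, g y * s.μ.map Y {y} = ENNReal.ofReal
      (∑ n, s.queryWeight y.2 * (s.shareWeight y.1 * (s.answerOf y.2 n y.1).length)) := by
    intro y
    rw [h2, Finset.sum_congr rfl (fun n _ => show s.queryWeight y.2 *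
      (s.shareWeight y.1 * (s.answerOf y.2 n y.1).length) =
      (s.shareWeight y.1 * s.queryWeight y.2) * (s.answerOf y.2 n y.1).length by ring),
      ← Finset.mul_sum, mul_comm, ENNReal.ofReal_mul (mul_nonneg (s.shareWeight_nonneg _)
        (s.queryWeight_nonneg _)), ← Nat.cast_sum, ENNReal.ofReal_natCast, Nat.cast_sum]
  simp_rw [h3]
  rw [← ENNReal.ofReal_sum_of_nonneg]
  · congr 1
    rw [Fintype.sum_prod_type_right]
    unfold expectedLength
    simp_rw [Finset.mul_sum]
    rw [Finset.sum_comm (s := Finset.univ (α := Fin N))]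
    exact Finset.sum_congr rfl fun q _ => Finset.sum_comm
  · exact fun y _ => Finset.sum_nonneg fun n _ => mul_nonneg (s.queryWeight_nonneg _)
      (mul_nonneg (s.shareWeight_nonneg _) (Nat.cast_nonneg _))

/-- For a fixed query vector of positive weight, the answers occurring with positive weight form a
prefix-free code. -/
lemma Feasible.meanEntropy_le [Nonempty F] (h : s.Feasible X T) (n : Fin N) :
    s.meanEntropy n ≤ s.expectedLength n * Real.log (Fintype.card F) := by
  unfold meanEntropy expectedLength
  rw [Finset.sum_mul]
  refine Finset.sum_le_sum fun q _ => ?_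
  rw [mul_assoc]
  rcases eq_or_ne (s.queryWeight q) 0 with hq | hq
  · simp [hq]
  refine mul_le_mul_of_nonneg_left ?_ (s.queryWeight_nonneg q)
  refine entropy_le_expected_length s.shareWeight_nonneg s.sum_shareWeight _ ?_
  have key : ∀ σ, s.shareWeight σ ≠ 0 →
      s.μ {ω | s.query ω n = q n ∧ s.answer ω n = s.answerOf q n σ} ≠ 0 := by
    intro σ hσ h0
    have h1 : s.μ {ω | s.share ω = σ ∧ s.query ω = q} = 0 := by
      refine measure_mono_null ?_ h0
      rintro ω ⟨rfl, rfl⟩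
      exact ⟨rfl, rfl⟩
    have := h.share_query_weight σ q
    rw [Measure.real, h1] at this
    exact mul_ne_zero hσ hq (by simpa using this.symm)
  exact fun σ τ hσ hτ => h.prefix_free n (q n) _ _ (key σ hσ) (key τ hτ)

/-- The converse bound for one desired message, averaged over the queries. -/
lemma Feasible.mean_bound (h : s.Feasible X T) (hT : 1 ≤ T) (hTN : T < N)
    {C C' : Finset (Fin N)} (hC : C.card = X) (hC' : C'.card = T) {i : MsgIdx K}
    {B : Set (MsgIdx K)} (hB : ∀ j : MsgIdx K, j.1 ≠ i.1 → j ∈ B) (hi : i ∉ B) :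
    L * Real.log (Fintype.card F) ≤
      ∑ n ∈ R i.1 \ (C ∪ C'), s.meanEntropy n +
        (∑ q, s.queryWeight q * s.equivocation C' B C q -
          ∑ q, s.queryWeight q * s.equivocation C' (insert i B) C q) := by
  classical
  set κ : ℝ := (Fintype.card (MsgIdx K) : ℝ)⁻¹ with hκ
  have hκ0 : 0 < κ := by
    rw [hκ]
    have : 0 < Fintype.card (MsgIdx K) := Fintype.card_pos_iff.2 ⟨i⟩
    positivity
  have h1 : ∑ q, s.jointQueryWeight i q * (L * Real.log (Fintype.card F)) ≤
      ∑ q, s.jointQueryWeight i q *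
        (∑ n ∈ R i.1 \ (C ∪ C'), entropy s.shareWeight (s.answerOf q n) +
          (s.equivocation C' B C q - s.equivocation C' (insert i B) C q)) := by
    refine Finset.sum_le_sum fun q _ => ?_
    rcases eq_or_ne (s.jointQueryWeight i q) 0 with hq | hq
    · simp [hq]
    exact mul_le_mul_of_nonneg_left (h.core_bound hC C' hB hi hq) (s.jointQueryWeight_nonneg i q)
  rw [← Finset.sum_mul, h.sum_jointQueryWeight] at h1
  simp_rw [mul_add, mul_sub] at h1
  rw [Finset.sum_add_distrib, Finset.sum_sub_distrib,
    h.sum_jointQueryWeight_mul hC' i _ (fun q q' e => equivocation_congr e),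
    h.sum_jointQueryWeight_mul hC' i _ (fun q q' e => equivocation_congr e)] at h1
  have h2 : ∑ q, s.jointQueryWeight i q *
      ∑ n ∈ R i.1 \ (C ∪ C'), entropy s.shareWeight (s.answerOf q n) =
      κ * ∑ n ∈ R i.1 \ (C ∪ C'), s.meanEntropy n := by
    simp_rw [Finset.mul_sum]
    rw [Finset.sum_comm]
    refine Finset.sum_congr rfl fun n _ => ?_
    -- Privacy speaks of exactly `T` servers, so the single server `n` is padded to a set of `T`
    -- servers.
    obtain ⟨D, hD, hDT⟩ := Finset.exists_superset_card_eq (s := {n}) (n := T) (by simpa using hT)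
      (by simpa using hTN.le)
    rw [h.sum_jointQueryWeight_mul hDT i _ (fun q q' e => by
      rw [answerOf_congr (e n (hD (Finset.mem_singleton_self n)))]), meanEntropy]
  rw [h2, ← mul_sub, ← mul_add] at h1
  exact le_of_mul_le_mul_left h1 hκ0

/-- The converse bound: the servers outside `C ∪ C'` have to deliver the desired message, up to an
error which vanishes for a large number of messages. -/
lemma Feasible.converse [Nontrivial F] (h : s.Feasible X T) (hT : 1 ≤ T) (hTN : T < N)
    {C C' : Finset (Fin N)} (hC : C.card = X) (hC' : C'.card = T) (m : Fin M) :
    (K m * L : ℝ) ≤ K m * ∑ n ∈ R m \ (C ∪ C'), s.expectedLength n +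
      ∑ n, s.expectedLength n := by
  classical
  set l := Real.log (Fintype.card F)
  have hl : 0 < l := Real.log_pos (by exact_mod_cast Fintype.one_lt_card)
  let B : ℕ → Set (MsgIdx K) := fun t => {j | j.1 = m → j.2.val < t}
  let E : ℕ → ℝ := fun t => ∑ q, s.queryWeight q * s.equivocation C' (B t) C q
  -- Revealing the messages of set `m` one at a time telescopes the mean equivocations `E`; only `E
  -- 0` and `E (K m)` survive, the first at most the total mean entropy, the second nonnegative.
  have step : ∀ t ≤ K m, t * (L * l) ≤
      t * ∑ n ∈ R m \ (C ∪ C'), s.meanEntropy n + (E 0 - E t) := by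
    intro t
    induction t with
    | zero => simp
    | succ t ih =>
      intro ht
      have := h.mean_bound hT hTN hC hC' (i := ⟨m, ⟨t, ht⟩⟩) (B := B t)
        (fun j hj => fun e => absurd e hj) (fun hmem => (hmem rfl).false)
      have hB : insert ⟨m, ⟨t, ht⟩⟩ (B t) = B (t + 1) := by
        ext ⟨m', k'⟩
        constructor
        · rintro (hj | hj)
          · intro hm
            obtain ⟨rfl, hj⟩ := Sigma.mk.inj_iff.1 hj
            rw [eq_of_heq hj]
            exact Nat.lt_succ_self t
          · exact fun hm => (hj hm).trans (Nat.lt_succ_self t)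
        · intro hj
          by_cases hm : m' = m
          · subst hm
            rcases Nat.lt_succ_iff_lt_or_eq.1 (hj rfl) with hk | hk
            · exact Or.inr fun _ => hk
            · exact Or.inl (by simp only at hk; congr; exact Fin.ext hk)
          · exact Or.inr fun e => absurd e hm
      rw [hB] at this
      have ih := ih (by omega)
      push_cast
      simp only [E] at ih ⊢
      linarith
  have hK := step (K m) le_rfl
  have hE : 0 ≤ E (K m) := Finset.sum_nonneg fun q _ =>
    mul_nonneg (s.queryWeight_nonneg q) (equivocation_nonneg _ _ _ _)
  have hE0 : E 0 ≤ ∑ n, s.meanEntropy n := by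
    calc E 0 ≤ ∑ q, s.queryWeight q * ∑ n ∈ C', entropy s.shareWeight (s.answerOf q n) :=
          Finset.sum_le_sum fun q _ =>
            mul_le_mul_of_nonneg_left (equivocation_le _ _ _ _) (s.queryWeight_nonneg q)
      _ = ∑ n ∈ C', s.meanEntropy n := by
          simp_rw [Finset.mul_sum]
          rw [Finset.sum_comm]
          rfl
      _ ≤ ∑ n, s.meanEntropy n := Finset.sum_le_sum_of_subset_of_nonneg (Finset.subset_univ _)
          fun n _ _ => s.meanEntropy_nonneg n
  have hd1 : ∑ n, s.meanEntropy n ≤ (∑ n, s.expectedLength n) * l := by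
    rw [Finset.sum_mul]
    exact Finset.sum_le_sum fun n _ => h.meanEntropy_le n
  have hd2 : ∑ n ∈ R m \ (C ∪ C'), s.meanEntropy n ≤
      (∑ n ∈ R m \ (C ∪ C'), s.expectedLength n) * l := by
    rw [Finset.sum_mul]
    exact Finset.sum_le_sum fun n _ => h.meanEntropy_le n
  have hd3 := mul_le_mul_of_nonneg_left hd2 (Nat.cast_nonneg (α := ℝ) (K m))
  refine le_of_mul_le_mul_right ?_ hl
  calc (K m * L : ℝ) * l = K m * (L * l) := by ring
    _ ≤ K m * ((∑ n ∈ R m \ (C ∪ C'), s.expectedLength n) * l) +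
        (∑ n, s.expectedLength n) * l := by linarith
    _ = _ := by ring

end Scheme

end GXSTPIR

namespace GXSTPIR

/-! ### Upper bounds on the capacity. -/

section Bounds

variable {F : Type} [Fintype F] {N M : ℕ} {R : Fin M → Finset (Fin N)} {K : Fin M → ℕ} {L : ℕ}
  {X T : ℕ}

lemma exists_cover {A : Finset (Fin N)} (hX : X ≤ N) (hT : T ≤ N) (hA : A.card ≤ X + T) :
    ∃ C C' : Finset (Fin N), C.card = X ∧ C'.card = T ∧ A ⊆ C ∪ C' := by
  classical
  obtain ⟨C₀, h1, h2⟩ := Finset.exists_subset_card_eq (min_le_left A.card X)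
  have h3 : (A \ C₀).card ≤ T := by
    rw [Finset.card_sdiff_of_subset h1]
    omega
  obtain ⟨C, h4, h5⟩ := Finset.exists_superset_card_eq (s := C₀) (n := X) (by omega) (by simpa)
  obtain ⟨C', h6, h7⟩ := Finset.exists_superset_card_eq h3 (by simpa)
  refine ⟨C, C', h5, h7, fun a ha => ?_⟩
  by_cases hc : a ∈ C₀
  · exact Finset.mem_union_left _ (h4 hc)
  · exact Finset.mem_union_right _ (h6 (Finset.mem_sdiff.2 ⟨ha, hc⟩))

/-- The at most `X + T` servers of `R m` outside `R'` are covered by some `C ∪ C'`. The inequality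
in `hc` admits `R' = ∅` when `R m` is small. -/
lemma Scheme.Feasible.converse_subset [Nontrivial F] {s : Scheme F R K L} (h : s.Feasible X T)
    (hX : X < N) (hT : 1 ≤ T) (hTN : T < N) {m : Fin M} {R' : Finset (Fin N)} (hR' : R' ⊆ R m)
    (hc : (R m).card ≤ R'.card + X + T) :
    (K m * L : ℝ) ≤ K m * ∑ n ∈ R', s.expectedLength n + ∑ n, s.expectedLength n := by
  classical
  obtain ⟨C, C', h1, h2, h3⟩ := exists_cover (A := R m \ R') hX.le hTN.le (by
    rw [Finset.card_sdiff_of_subset hR']; omega)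
  refine (h.converse hT hTN h1 h2 m).trans (add_le_add_left (mul_le_mul_of_nonneg_left ?_
    (Nat.cast_nonneg _)) _)
  refine Finset.sum_le_sum_of_subset_of_nonneg ?_ fun n _ _ => s.expectedLength_nonneg n
  intro n hn
  rw [Finset.mem_sdiff] at hn
  by_contra hcon
  exact hn.2 (h3 (Finset.mem_sdiff.2 ⟨hn.1, hcon⟩))

lemma Scheme.Feasible.rate_le {s : Scheme F R K L} (h : s.Feasible X T) {b : ℝ} (hb : 0 ≤ b)
    (hL : L ≤ b * ∑ n, s.expectedLength n) : s.rate ≤ ENNReal.ofReal b := by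
  rw [Scheme.rate, h.download_eq]
  refine ENNReal.div_le_of_le_mul ?_
  rw [← ENNReal.ofReal_mul hb, ← ENNReal.ofReal_natCast]
  exact ENNReal.ofReal_le_ofReal hL

lemma capacity_le_of_rate_le {b : ℝ≥0∞}
    (h : ∀ (L : ℕ), 0 < L → ∀ s : Scheme F R K L, s.Feasible X T → s.rate ≤ b) :
    capacity F R X T K ≤ b :=
  iSup_le fun L => iSup_le fun hL => iSup_le fun s => iSup_le fun hs => h L hL s hs

lemma capacity_le_inv_of_card_le [Nontrivial F] (hX : X < N) (hT : 1 ≤ T) (hTN : T < N)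
    {m : Fin M} (hm : (R m).card ≤ X + T) (hK : 0 < K m) :
    capacity F R X T K ≤ ENNReal.ofReal (K m : ℝ)⁻¹ := by
  refine capacity_le_of_rate_le fun L _ s hs => hs.rate_le (by positivity) ?_
  have h1 := hs.converse_subset hX hT hTN (m := m) (R' := ∅) (by simp) (by simpa using hm)
  have h2 : (0 : ℝ) < K m := by exact_mod_cast hK
  rw [Finset.sum_empty, mul_zero, zero_add] at h1
  rw [inv_mul_eq_div, le_div_iff₀ h2]
  linarith

/-- With `S` the total expected length and `η = ∑ (K m)⁻¹`, the expected lengths divided by `L - S *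
η` solve the linear program, so `(L - S * η) / S ≤ c`. Taking the sum for `η` bounds all `(K m)⁻¹`
at once. -/
lemma capacity_le_of_isGreatest [Nontrivial F] (hM : 0 < M) (hX : X < N) (hT : 1 ≤ T)
    (hTN : T < N) (hR : ∀ m, X + T < (R m).card) (hK : ∀ m, 0 < K m) {c : ℝ} (hc : 0 ≤ c)
    (hmax : ∀ D ∈ feasibleRegion R X T, (∑ n, D n)⁻¹ ≤ c) :
    capacity F R X T K ≤ ENNReal.ofReal (c + ∑ m, (K m : ℝ)⁻¹) := by
  have hη : 0 ≤ ∑ m, (K m : ℝ)⁻¹ := Finset.sum_nonneg fun m _ => by positivity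
  refine capacity_le_of_rate_le fun L hL s hs => hs.rate_le (by positivity) ?_
  set η := ∑ m, (K m : ℝ)⁻¹
  set S := ∑ n, s.expectedLength n
  have hS : 0 ≤ S := Finset.sum_nonneg fun n _ => s.expectedLength_nonneg n
  have key : ∀ m, ∀ R' ⊆ R m, R'.card + X + T = (R m).card →
      L - S * η ≤ ∑ n ∈ R', s.expectedLength n := by
    intro m R' h1 h2
    have h3 := hs.converse_subset hX hT hTN h1 h2.ge
    have h4 : (0 : ℝ) < K m := by exact_mod_cast hK m
    have h5 : (K m : ℝ)⁻¹ ≤ η :=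
      Finset.single_le_sum (f := fun m => (K m : ℝ)⁻¹) (fun m _ => by positivity)
        (Finset.mem_univ m)
    have h6 := mul_le_mul_of_nonneg_left h5 hS
    have h7 : (L : ℝ) ≤ ∑ n ∈ R', s.expectedLength n + S * (K m : ℝ)⁻¹ := by
      rw [← mul_le_mul_iff_right₀ h4, mul_add, mul_comm S, mul_inv_cancel_left₀ h4.ne']
      exact h3
    linarith
  -- Without a positive normaliser the claim `L ≤ (c + η) * S` is immediate.
  rcases le_or_gt ((L : ℝ) - S * η) 0 with ht | ht
  · nlinarith [mul_nonneg hc hS]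
  obtain ⟨R', h1, h2⟩ := Finset.exists_subset_card_eq
    (s := R ⟨0, hM⟩) (n := (R ⟨0, hM⟩).card - (X + T)) (by omega)
  have hSt : L - S * η ≤ S := (key ⟨0, hM⟩ R' h1 (by have := hR ⟨0, hM⟩; omega)).trans
    (Finset.sum_le_sum_of_subset_of_nonneg (Finset.subset_univ _)
      fun n _ _ => s.expectedLength_nonneg n)
  have hS0 : 0 < S := ht.trans_le hSt
  have := hmax (fun n => s.expectedLength n / (L - S * η))
    ⟨fun n => div_nonneg (s.expectedLength_nonneg n) ht.le, fun m R' h1 h2 => by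
      rw [← Finset.sum_div, le_div_iff₀ ht, one_mul]
      exact key m R' h1 h2⟩
  rw [← Finset.sum_div, inv_div, div_le_iff₀ hS0] at this
  linarith

end Bounds

/-! ### The linear program: attainment and rounding. -/

section LinearProgram

variable {N M : ℕ} {R : Fin M → Finset (Fin N)} {X T : ℕ}

lemma one_le_sum_of_mem_feasibleRegion (hM : 0 < M) (hR : ∀ m, X + T < (R m).card)
    {D : Fin N → ℝ} (hD : D ∈ feasibleRegion R X T) : 1 ≤ ∑ n, D n := by
  obtain ⟨R', h1, h2⟩ := Finset.exists_subset_card_eq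
    (s := R ⟨0, hM⟩) (n := (R ⟨0, hM⟩).card - (X + T)) (by omega)
  exact (hD.2 ⟨0, hM⟩ R' h1 (by have := hR ⟨0, hM⟩; omega)).trans
    (Finset.sum_le_sum_of_subset_of_nonneg (Finset.subset_univ _) fun n _ _ => hD.1 n)

lemma isClosed_feasibleRegion : IsClosed (feasibleRegion R X T) := by
  have : feasibleRegion R X T = (⋂ n, {D : Fin N → ℝ | 0 ≤ D n}) ∩
      ⋂ m, ⋂ R' : Finset (Fin N), ⋂ (_ : R' ⊆ R m), ⋂ (_ : R'.card + X + T = (R m).card),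
        {D : Fin N → ℝ | 1 ≤ ∑ n ∈ R', D n} := by
    ext D
    simp [feasibleRegion]
  rw [this]
  refine (isClosed_iInter fun n => isClosed_le (by fun_prop) (by fun_prop)).inter ?_
  exact isClosed_iInter fun m => isClosed_iInter fun R' => isClosed_iInter fun _ =>
    isClosed_iInter fun _ => isClosed_le (by fun_prop) (by fun_prop)

/-- The linear program has an optimal solution. -/
lemma exists_min_feasibleRegion (hR : ∀ m, X + T < (R m).card) :
    ∃ D ∈ feasibleRegion R X T, ∀ D' ∈ feasibleRegion R X T, ∑ n, D n ≤ ∑ n, D' n := by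
  have hone : (fun _ => 1 : Fin N → ℝ) ∈ feasibleRegion R X T := by
    refine ⟨fun _ => zero_le_one, fun m R' _ h2 => ?_⟩
    have : 1 ≤ R'.card := by have := hR m; omega
    simpa using this
  -- The all-ones point is feasible with value `N`, so larger values may be discarded, which makes
  -- the region compact.
  let P := feasibleRegion R X T ∩ {D | ∑ n, D n ≤ N}
  have hP : IsCompact P := by
    refine IsCompact.of_isClosed_subset (isCompact_Icc (a := (0 : Fin N → ℝ)) (b := fun _ => N))
      (isClosed_feasibleRegion.inter (isClosed_le (by fun_prop) (by fun_prop))) ?_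
    rintro D ⟨h1, h2⟩
    exact ⟨fun n => h1.1 n, fun n =>
      (Finset.single_le_sum (fun n _ => h1.1 n) (Finset.mem_univ n)).trans h2⟩
  obtain ⟨D, h1, h2⟩ := hP.exists_isMinOn ⟨fun _ => 1, hone, by simp⟩
    (f := fun D : Fin N → ℝ => ∑ n, D n) (by fun_prop)
  refine ⟨D, h1.1, fun D' hD' => ?_⟩
  by_cases h : ∑ n, D' n ≤ N
  · exact h2 ⟨hD', h⟩
  · exact h1.2.trans (not_le.1 h).le

/-- Rounding a real solution of the linear program shows that its value is achieved, if all
integral solutions are. -/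
lemma ofReal_inv_le_of_forall_nat (hM : 0 < M) (hR : ∀ m, X + T < (R m).card) {D : Fin N → ℝ}
    (hD : D ∈ feasibleRegion R X T) {C : ℝ≥0∞}
    (h : ∀ (L : ℕ) (d : Fin N → ℕ), 0 < L →
      (∀ m, ∀ R' ⊆ R m, R'.card + X + T = (R m).card → L ≤ ∑ n ∈ R', d n) →
      (L : ℝ≥0∞) / (∑ n, d n : ℕ) ≤ C) :
    ENNReal.ofReal (∑ n, D n)⁻¹ ≤ C := by
  set S := ∑ n, D n
  have hS : 0 < S := zero_lt_one.trans_le (one_le_sum_of_mem_feasibleRegion hM hR hD)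
  have hlim : Tendsto (fun L : ℕ => ENNReal.ofReal (S + N / L)⁻¹) atTop
      (𝓝 (ENNReal.ofReal (S + 0)⁻¹)) := by
    refine ENNReal.tendsto_ofReal (Tendsto.inv₀ (tendsto_const_nhds.add ?_) (by simpa using hS.ne'))
    exact tendsto_const_div_atTop_nhds_zero_nat _
  rw [add_zero] at hlim
  refine le_of_tendsto hlim ?_
  filter_upwards [eventually_gt_atTop 0] with L hL
  have hL' : (0 : ℝ) < L := by exact_mod_cast hL
  -- Rounding `L * D n` up keeps every constraint and costs at most one unit per server, hence the
  -- rate `1 / (S + N / L)`.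
  refine le_trans ?_ (h L (fun n => ⌈L * D n⌉₊) hL fun m R' h1 h2 => ?_)
  · have h3 : ((∑ n, ⌈L * D n⌉₊ : ℕ) : ℝ) ≤ L * S + N := by
      push_cast
      calc ∑ n, (⌈L * D n⌉₊ : ℝ) ≤ ∑ n, (L * D n + 1) := Finset.sum_le_sum fun n _ =>
            (Nat.ceil_lt_add_one (mul_nonneg hL'.le (hD.1 n))).le
        _ = L * S + N := by simp [Finset.sum_add_distrib, Finset.mul_sum, S]
    rw [ENNReal.le_div_iff_mul_le (Or.inr (by simpa using hL.ne')) (Or.inl (by simp)),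
      ← ENNReal.ofReal_natCast (n := ∑ n, ⌈L * D n⌉₊), ← ENNReal.ofReal_mul (by positivity),
      ← ENNReal.ofReal_natCast]
    refine ENNReal.ofReal_le_ofReal ?_
    rw [inv_mul_le_iff₀ (by positivity)]
    refine h3.trans (le_of_eq ?_)
    field_simp
  · have h3 := mul_le_mul_of_nonneg_left (hD.2 m R' h1 h2) hL'.le
    have h4 : (L : ℝ) ≤ (∑ n ∈ R', ⌈L * D n⌉₊ : ℕ) := by
      push_cast
      rw [mul_one, Finset.mul_sum] at h3
      exact h3.trans (Finset.sum_le_sum fun n _ => Nat.le_ceil _)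
    exact_mod_cast h4

end LinearProgram

end GXSTPIR

namespace GXSTPIR

/-! ### Independence under the uniform measure by counting. -/

section Uniform

variable {Ω A B α β : Type} [Fintype Ω] [Nonempty Ω]

/-- The uniform distribution on a finite type, all of whose subsets are measurable. -/
noncomputable def uniformMeasure (Ω : Type) [Fintype Ω] : @Measure Ω ⊤ :=
  @uniformOn Ω ⊤ Set.univ

lemma isProbabilityMeasure_uniformMeasure : @IsProbabilityMeasure Ω ⊤ (uniformMeasure Ω) := by
  let _ : MeasurableSpace Ω := ⊤
  exact instIsProbabilityMeasure_uniformOn_univ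

lemma uniformMeasure_apply (P : Ω → Prop) [DecidablePred P] :
    uniformMeasure Ω {ω | P ω} =
      ENNReal.ofReal ((Finset.univ.filter P).card / Fintype.card Ω) := by
  let _ : MeasurableSpace Ω := ⊤
  have h : ({ω | P ω} : Set Ω) = ↑(Finset.univ.filter P) := by ext; simp
  have hpos : (0 : ℝ) < Fintype.card Ω := by exact_mod_cast Fintype.card_pos
  rw [uniformMeasure, uniformOn_univ, h, Measure.count_apply_finset, ENNReal.ofReal_div_of_pos hpos,
    ENNReal.ofReal_natCast, ENNReal.ofReal_natCast]

lemma card_filter_equiv_prod {Ω A B : Type} [Fintype Ω] [Fintype A] [Fintype B] (e : Ω ≃ A × B)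
    (P : A → Prop) (Q : B → Prop) [DecidablePred P] [DecidablePred Q] :
    (Finset.univ.filter fun ω => P (e ω).1 ∧ Q (e ω).2).card =
      (Finset.univ.filter P).card * (Finset.univ.filter Q).card := by
  rw [← Finset.card_product]
  refine Finset.card_bij' (fun ω _ => e ω) (fun x _ => e.symm x) ?_ ?_ ?_ ?_ <;>
    simp +contextual

/-- Security and privacy of the code reduce to finding a bijection of the sample space onto a
product in which the two variables read different factors. -/
lemma discreteIndep_of_equiv_prod [Finite A] [Finite B] (e : Ω ≃ A × B) (φ : A → α) (ψ : B → β) :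
    @DiscreteIndep Ω α β ⊤ (uniformMeasure Ω) (fun ω => φ (e ω).1) (fun ω => ψ (e ω).2) := by
  classical
  have : Fintype A := Fintype.ofFinite A
  have : Fintype B := Fintype.ofFinite B
  let _ : MeasurableSpace Ω := ⊤
  let _ : MeasurableSpace α := ⊤
  let _ : MeasurableSpace β := ⊤
  have : Nonempty A := ⟨(e (Classical.arbitrary Ω)).1⟩
  have : Nonempty B := ⟨(e (Classical.arbitrary Ω)).2⟩
  refine indepFun_iff_measure_inter_preimage_eq_mul.2 fun s t _ _ => ?_
  -- The trivial conjuncts in the marginal events bring all three to product form for one counting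
  -- lemma.
  have h1 := uniformMeasure_apply (Ω := Ω) fun ω => φ (e ω).1 ∈ s ∧ ψ (e ω).2 ∈ t
  have h2 := uniformMeasure_apply (Ω := Ω) fun ω => φ (e ω).1 ∈ s ∧ True
  have h3 := uniformMeasure_apply (Ω := Ω) fun ω => True ∧ ψ (e ω).2 ∈ t
  rw [card_filter_equiv_prod e (fun a => φ a ∈ s) (fun b => ψ b ∈ t)] at h1
  rw [card_filter_equiv_prod e (fun a => φ a ∈ s) (fun _ => True)] at h2
  rw [card_filter_equiv_prod e (fun _ => True) (fun b => ψ b ∈ t)] at h3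
  simp only [and_true, true_and] at h2 h3
  have e1 : ∀ (u : Set α), (fun ω => φ (e ω).1) ⁻¹' u = {ω | φ (e ω).1 ∈ u} := fun _ => rfl
  have e2 : ∀ (u : Set β), (fun ω => ψ (e ω).2) ⁻¹' u = {ω | ψ (e ω).2 ∈ u} := fun _ => rfl
  have e3 : {ω | φ (e ω).1 ∈ s} ∩ {ω | ψ (e ω).2 ∈ t} = {ω | φ (e ω).1 ∈ s ∧ ψ (e ω).2 ∈ t} := rfl
  rw [e1, e2, e3, h1, h2, h3, ← ENNReal.ofReal_mul (by positivity), Fintype.card_congr e,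
    Fintype.card_prod]
  have hA : (Fintype.card A : ℝ) ≠ 0 := by exact_mod_cast Fintype.card_ne_zero
  have hB : (Fintype.card B : ℝ) ≠ 0 := by exact_mod_cast Fintype.card_ne_zero
  congr 1
  simp only [Finset.filter_true, Finset.card_univ]
  push_cast
  field_simp

lemma mutuallyIndep_of_equiv_pi {ι : Type} [Finite ι] {A' α' : ι → Type} [∀ i, Finite (A' i)]
    [Finite B] (e : Ω ≃ ((i : ι) → A' i) × B) (φ : (i : ι) → A' i → α' i) :
    @MutuallyIndep Ω ι α' ⊤ (uniformMeasure Ω) (fun i ω => φ i ((e ω).1 i)) := by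
  classical
  have : Fintype ι := Fintype.ofFinite ι
  have : ∀ i, Fintype (A' i) := fun i => Fintype.ofFinite _
  have : Fintype B := Fintype.ofFinite B
  let _ : MeasurableSpace Ω := ⊤
  have : Nonempty B := ⟨(e (Classical.arbitrary Ω)).2⟩
  have : ∀ i, Nonempty (A' i) := fun i => ⟨(e (Classical.arbitrary Ω)).1 i⟩
  have key : ∀ (S : Finset ι) (s : (i : ι) → Set (α' i)),
      uniformMeasure Ω (⋂ i ∈ S, (fun ω => φ i ((e ω).1 i)) ⁻¹' s i) = ENNReal.ofReal (∏ i ∈ S,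
        ((Finset.univ.filter fun a => φ i a ∈ s i).card / Fintype.card (A' i) : ℝ)) := by
    intro S s
    have h1 := uniformMeasure_apply (Ω := Ω) fun ω => (∀ i ∈ S, φ i ((e ω).1 i) ∈ s i) ∧ True
    rw [card_filter_equiv_prod e (fun a => ∀ i ∈ S, φ i (a i) ∈ s i) (fun _ => True)] at h1
    have h2 : (Finset.univ.filter fun a : (i : ι) → A' i => ∀ i ∈ S, φ i (a i) ∈ s i) =
        Fintype.piFinset fun i => if i ∈ S then Finset.univ.filter fun a => φ i a ∈ s i
          else Finset.univ := by
      ext a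
      simp only [Finset.mem_filter, Finset.mem_univ, true_and, Fintype.mem_piFinset]
      refine forall_congr' fun i => ?_
      split_ifs with hi <;> simp [hi]
    have h3 : (⋂ i ∈ S, (fun ω => φ i ((e ω).1 i)) ⁻¹' s i) =
        {ω | (∀ i ∈ S, φ i ((e ω).1 i) ∈ s i) ∧ True} := by
      ext ω; simp
    rw [h3, h1, h2, Fintype.card_piFinset, Fintype.card_congr e, Fintype.card_prod,
      Fintype.card_pi]
    congr 1
    have hB : (Fintype.card B : ℝ) ≠ 0 := by exact_mod_cast Fintype.card_ne_zero
    simp only [Finset.filter_true, Finset.card_univ]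
    push_cast
    rw [mul_div_mul_right _ _ hB, ← Finset.prod_div_distrib, ← Finset.prod_subset S.subset_univ]
    · exact Finset.prod_congr rfl fun i hi => by rw [if_pos hi]
    · intro i _ hi
      rw [if_neg hi, Finset.card_univ, div_self]
      exact_mod_cast Fintype.card_ne_zero
  unfold MutuallyIndep
  refine (@iIndepFun_iff_measure_inter_preimage_eq_mul _ _ _ _ _ (fun _ => ⊤) _).2 fun S s _ => ?_
  rw [key S s, ENNReal.ofReal_prod_of_nonneg fun i _ => by positivity]
  refine Finset.prod_congr rfl fun i _ => ?_
  have := key {i} s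
  simp only [Finset.mem_singleton, Set.iInter_iInter_eq_left, Finset.prod_singleton] at this
  exact this.symm

lemma isUniform_of_equiv_prod [Finite B] [Fintype α] (e : Ω ≃ A × B) (φ : A ≃ α) :
    @IsUniform Ω α ⊤ _ (uniformMeasure Ω) (fun ω => φ (e ω).1) := by
  classical
  have : Fintype A := Fintype.ofEquiv α φ.symm
  have : Fintype B := Fintype.ofFinite B
  have : Nonempty B := ⟨(e (Classical.arbitrary Ω)).2⟩
  have : Nonempty α := ⟨φ (e (Classical.arbitrary Ω)).1⟩
  intro a
  have h1 := uniformMeasure_apply (Ω := Ω) fun ω => φ (e ω).1 = a ∧ True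
  rw [card_filter_equiv_prod e (fun x => φ x = a) (fun _ => True)] at h1
  simp only [and_true] at h1
  have h2 : (Finset.univ.filter fun x => φ x = a) = {φ.symm a} := by
    ext x
    simp [Equiv.eq_symm_apply]
  rw [h1, h2, Fintype.card_congr e, Fintype.card_prod, Fintype.card_congr φ]
  have hA : (0 : ℝ) < Fintype.card α := by exact_mod_cast Fintype.card_pos
  have hB : (Fintype.card B : ℝ) ≠ 0 := by exact_mod_cast Fintype.card_ne_zero
  simp only [Finset.filter_true, Finset.card_univ, Finset.card_singleton]
  push_cast
  rw [mul_div_mul_right _ _ hB, one_div, ENNReal.ofReal_inv_of_pos hA, ENNReal.ofReal_natCast]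

lemma determinedBy_of_injective {Ω α β : Type} [Nonempty Ω] [MeasurableSpace Ω] (μ : Measure Ω)
    {f : Ω → α} {g : Ω → β} (h : ∀ ω ω', g ω = g ω' → f ω = f ω') : DeterminedBy μ f g := by
  have : Nonempty α := ⟨f (Classical.arbitrary Ω)⟩
  refine ⟨Function.extend g f fun _ => Classical.arbitrary α, Eventually.of_forall fun ω => ?_⟩
  exact (Function.FactorsThrough.extend_apply (fun a b e => h a b e) _ ω).symm

end Uniform

/-! ### Polynomial identities behind cross-subspace alignment. -/

section Polynomial

open Polynomial

variable {E : Type} [Field E] {ι : Type} {k : ℕ}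

/-- A polynomial of small degree that takes the values `(f - a)⁻¹` at given points `a`. -/
lemma exists_mul_eval_eq_one {P : Finset ι} {α : ι → E} (hα : Set.InjOn α P) (hk : P.card ≤ k)
    {f : E} (hf : ∀ a ∈ P, f ≠ α a) :
    ∃ τ : degreeLT E k, ∀ a ∈ P, (f - α a) * τ.1.eval (α a) = 1 := by
  classical
  refine ⟨⟨Lagrange.interpolate P α fun a => (f - α a)⁻¹, mem_degreeLT.2 ?_⟩, fun a ha => ?_⟩
  · exact (Lagrange.degree_interpolate_lt _ hα).trans_le (by exact_mod_cast hk)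
  · rw [Lagrange.eval_interpolate_at_node _ hα ha, mul_inv_cancel₀ (sub_ne_zero.2 (hf a ha))]

/-- A secret masked by noise of small degree is determined by enough evaluations. -/
lemma eq_of_masked_eq {P : Finset ι} {α : ι → E} (hα : Set.InjOn α P) (hk : k < P.card)
    {f w w' : E} {z z' : degreeLT E k}
    (h : ∀ a ∈ P, w + (f - α a) * z.1.eval (α a) = w' + (f - α a) * z'.1.eval (α a)) :
    w = w' := by
  have hz : (z.1 - z'.1).degree < k := mem_degreeLT.1 (sub_mem z.2 z'.2)
  -- The difference of the two masked values is a polynomial of degree at most `k` with more than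
  -- `k` zeros; at `f` the noise term drops out.
  have h0 : C (w - w') + (C f - X) * (z.1 - z'.1) = 0 := by
    refine eq_zero_of_degree_lt_of_eval_index_eq_zero (v := α) P hα ?_ ?_
    · refine (degree_add_le _ _).trans_lt (max_lt ?_ ?_)
      · exact degree_C_le.trans_lt (by exact_mod_cast (Nat.zero_le k).trans_lt hk)
      · by_cases hzz : z.1 - z'.1 = 0
        · rw [hzz, mul_zero, degree_zero]
          exact WithBot.bot_lt_coe _
        rw [degree_mul, degree_eq_natDegree hzz] at *
        have : (C f - X : E[X]).degree = 1 := by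
          rw [← neg_sub, degree_neg, degree_X_sub_C]
        rw [this]
        have hz' : (z.1 - z'.1).natDegree < k := by exact_mod_cast hz
        exact_mod_cast (by omega : 1 + (z.1 - z'.1).natDegree < P.card)
    · intro a ha
      have := h a ha
      simp only [eval_add, eval_C, eval_mul, eval_sub, eval_X]
      linear_combination this
  have := congrArg (eval f) h0
  simpa [sub_eq_zero] using this

/-- By Lagrange interpolation the sum is the coefficient of `X ^ (P.card - 1)` in `g`. -/
lemma sum_nodalWeight_mul_eval_eq_zero [DecidableEq ι] {P : Finset ι} {α : ι → E}
    (hα : Set.InjOn α P) {g : E[X]} (hg : g.degree < (P.card - 1 : ℕ)) :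
    ∑ a ∈ P, Lagrange.nodalWeight P α a * g.eval (α a) = 0 := by
  have h1 : g.degree < P.card := hg.trans_le (by exact_mod_cast Nat.sub_le _ _)
  rw [← coeff_eq_zero_of_degree_lt hg, Lagrange.coeff_eq_sum hα h1]
  refine Finset.sum_congr rfl fun a _ => ?_
  rw [Lagrange.nodalWeight, Finset.prod_inv_distrib, div_eq_inv_mul]

/-- Interference cancels in the combination of the answers by which the user decodes. -/
lemma decode_identity [DecidableEq ι] {P : Finset ι} {α : ι → E} (hα : Set.InjOn α P)
    {κ : Type} [Fintype κ] {x t L : ℕ} (hP : L + (x + t) ≤ P.card) {f : κ → E}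
    (hf : ∀ ℓ, ∀ a ∈ P, f ℓ ≠ α a) {u : E[X]} (hu : u.degree < L) (b : E) (w : κ → E)
    (z : κ → degreeLT E x) (z' : κ → degreeLT E t) :
    ∑ a ∈ P, u.eval (α a) * (Lagrange.nodalWeight P α a * ∑ ℓ,
      (w ℓ + (f ℓ - α a) * (z ℓ).1.eval (α a)) * (b + (f ℓ - α a) * (z' ℓ).1.eval (α a)) *
        (f ℓ - α a)⁻¹) =
      b * ∑ ℓ, w ℓ * u.eval (f ℓ) * ((Lagrange.nodal P α).eval (f ℓ))⁻¹ := by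
  simp_rw [Finset.mul_sum]
  rw [Finset.sum_comm]
  refine Finset.sum_congr rfl fun ℓ _ => ?_
  -- The product of masked share and masked query, divided by `f ℓ - α a`, is `b * w ℓ / (f ℓ - α a)
  -- + g (α a)`: a Cauchy term and polynomial interference.
  set g : E[X] := C b * (z ℓ).1 + C (w ℓ) * (z' ℓ).1 + (C (f ℓ) - X) * ((z ℓ).1 * (z' ℓ).1)
    with hg
  have hsplit : ∀ a ∈ P, u.eval (α a) * (Lagrange.nodalWeight P α a *
      ((w ℓ + (f ℓ - α a) * (z ℓ).1.eval (α a)) * (b + (f ℓ - α a) * (z' ℓ).1.eval (α a)) *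
        (f ℓ - α a)⁻¹)) =
      b * w ℓ * (Lagrange.nodalWeight P α a * (f ℓ - α a)⁻¹ * u.eval (α a)) +
        Lagrange.nodalWeight P α a * (u * g).eval (α a) := by
    intro a ha
    have hne : f ℓ - α a ≠ 0 := sub_ne_zero.2 (hf ℓ a ha)
    simp only [hg, eval_add, eval_mul, eval_C, eval_sub, eval_X]
    field_simp
    ring
  rw [Finset.sum_congr rfl hsplit, Finset.sum_add_distrib, ← Finset.mul_sum]
  have hz : (z ℓ).1.degree < x := mem_degreeLT.1 (z ℓ).2
  have hz' : (z' ℓ).1.degree < t := mem_degreeLT.1 (z' ℓ).2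
  have hgd : g.degree < (x + t : ℕ) := by
    have hC : ∀ (c : E) (p : E[X]) (n : ℕ), p.degree < n → (C c * p).degree < n := by
      intro c p n hp
      exact mem_degreeLT.1 (by
        rw [← smul_eq_C_mul]
        exact Submodule.smul_mem _ c (mem_degreeLT.2 hp))
    refine (degree_add_le _ _).trans_lt (max_lt ((degree_add_le _ _).trans_lt (max_lt ?_ ?_)) ?_)
    · exact (hC _ _ _ hz).trans_le (by exact_mod_cast Nat.le_add_right x t)
    · exact (hC _ _ _ hz').trans_le (by exact_mod_cast Nat.le_add_left t x)
    · by_cases h1 : (z ℓ).1 = 0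
      · rw [h1, zero_mul, mul_zero, degree_zero]
        exact WithBot.bot_lt_coe _
      by_cases h2 : (z' ℓ).1 = 0
      · rw [h2, mul_zero, mul_zero, degree_zero]
        exact WithBot.bot_lt_coe _
      have : (C (f ℓ) - X : E[X]).degree = 1 := by
        rw [← neg_sub, degree_neg, degree_X_sub_C]
      rw [degree_mul, degree_mul, this, degree_eq_natDegree h1, degree_eq_natDegree h2]
      rw [degree_eq_natDegree h1] at hz
      rw [degree_eq_natDegree h2] at hz'
      have e1 : (z ℓ).1.natDegree < x := by exact_mod_cast hz
      have e2 : (z' ℓ).1.natDegree < t := by exact_mod_cast hz'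
      exact_mod_cast (by omega : 1 + ((z ℓ).1.natDegree + (z' ℓ).1.natDegree) < x + t)
  -- For nonzero factors the degrees are at most `L - 1` and `x + t - 1`, so their sum is at most
  -- `P.card - 2`.
  have hug : (u * g).degree < (P.card - 1 : ℕ) := by
    by_cases h1 : u = 0
    · rw [h1, zero_mul, degree_zero]
      exact WithBot.bot_lt_coe _
    by_cases h2 : g = 0
    · rw [h2, mul_zero, degree_zero]
      exact WithBot.bot_lt_coe _
    rw [degree_mul, degree_eq_natDegree h1, degree_eq_natDegree h2]
    rw [degree_eq_natDegree h1] at hu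
    rw [degree_eq_natDegree h2] at hgd
    have e1 : u.natDegree < L := by exact_mod_cast hu
    have e2 : g.natDegree < x + t := by exact_mod_cast hgd
    exact_mod_cast (by omega : u.natDegree + g.natDegree < P.card - 1)
  rw [sum_nodalWeight_mul_eval_eq_zero hα hug, add_zero]
  -- The barycentric formula at `f ℓ` evaluates the Cauchy term to `u (f ℓ)` over the nodal
  -- polynomial.
  have hint : u = Lagrange.interpolate P α fun a => u.eval (α a) :=
    Lagrange.eq_interpolate hα (hu.trans_le (by exact_mod_cast (Nat.le_add_right _ _).trans hP))
  have hev := Lagrange.eval_interpolate_not_at_node (s := P) (v := α) (fun a => u.eval (α a)) (hf ℓ)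
  rw [← hint] at hev
  have hnod : (Lagrange.nodal P α).eval (f ℓ) ≠ 0 := Lagrange.eval_nodal_not_at_node (hf ℓ)
  rw [hev]
  field_simp

end Polynomial

end GXSTPIR

/-! ### The cross-subspace alignment code. -/

namespace GXSTPIR

open Polynomial

instance finite_degreeLT {E : Type} [Field E] [Finite E] (k : ℕ) : Finite (degreeLT E k) :=
  Finite.of_equiv _ (degreeLTEquiv E k).symm.toEquiv

/-- The data of a cross-subspace alignment code over the field `E`: server `n` is divided into
`d n` virtual servers, of which the first `δ m` take part in the storage of the `m`-th message
set. -/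
structure AlignmentCode (F : Type) {N M : ℕ} (R : Fin M → Finset (Fin N)) (X T L : ℕ) where
  E : Type
  [field : Field E]
  [fintype : Fintype E]
  d : Fin N → ℕ
  δ : Fin M → ℕ
  point : (Σ n, Fin (d n)) → E
  node : Fin L → E
  point_injective : Function.Injective point
  node_injective : Function.Injective node
  node_ne_point : ∀ ℓ v, node ℓ ≠ point v
  /-- the number of symbols of `F` that encode an element of `E` -/
  width : ℕ
  encode : (k : ℕ) → (Fin k → E) ≃ (Fin (k * width) → F)
  -- The active points must accommodate `L` desired symbols and interference of degree below `(X +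
  -- T) * δ m`.
  le_sum_min : ∀ m, L + (X * δ m + T * δ m) ≤ ∑ n ∈ R m, min (d n) (δ m)

namespace AlignmentCode

attribute [instance] AlignmentCode.field AlignmentCode.fintype

variable {F : Type} {N M : ℕ} {R : Fin M → Finset (Fin N)} {X T L : ℕ}
  (c : AlignmentCode F R X T L) {K : Fin M → ℕ}

/-- The virtual servers that take part in the storage of the `m`-th message set. -/
def active (m : Fin M) : Finset (Σ n, Fin (c.d n)) :=
  (R m).sigma fun _ => Finset.univ.filter fun j => j.val < c.δ m

lemma mem_active {m : Fin M} {v : Σ n, Fin (c.d n)} :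
    v ∈ c.active m ↔ v.1 ∈ R m ∧ v.2.val < c.δ m := by
  simp [active]

lemma le_card_active (m : Fin M) : L + (X * c.δ m + T * c.δ m) ≤ (c.active m).card := by
  refine (c.le_sum_min m).trans (le_of_eq ?_)
  rw [active, Finset.card_sigma]
  refine Finset.sum_congr rfl fun n _ => ?_
  rw [Fin.card_filter_val_lt]

/-- Colluding servers thus see no more evaluations of the noise than it has free coefficients. -/
lemma card_active_filter_le (m : Fin M) (C : Finset (Fin N)) :
    ((c.active m).filter fun v => v.1 ∈ C).card ≤ C.card * c.δ m := by
  rw [← Finset.card_range (c.δ m), ← Finset.card_product]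
  refine Finset.card_le_card_of_injOn (fun v => (v.1, v.2.val)) ?_ ?_
  · intro v hv
    have := Finset.mem_filter.1 hv
    have h2 := c.mem_active.1 this.1
    exact Finset.mem_product.2 ⟨this.2, Finset.mem_range.2 h2.2⟩
  · rintro ⟨n, j⟩ _ ⟨n', j'⟩ _ h
    simp only [Prod.mk.injEq] at h
    obtain ⟨rfl, h⟩ := h
    congr
    exact Fin.ext h

/-- Noise that cancels a unit secret at all virtual servers of the servers in `C`. -/
lemma exists_cancel {C : Finset (Fin N)} {x : ℕ} (hC : C.card = x) :
    ∃ τ : (m : Fin M) → Fin L → degreeLT c.E (x * c.δ m), ∀ m ℓ, ∀ v ∈ c.active m, v.1 ∈ C →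
      (c.node ℓ - c.point v) * (τ m ℓ).1.eval (c.point v) = 1 := by
  have : ∀ m ℓ, ∃ τ : degreeLT c.E (x * c.δ m), ∀ v ∈ (c.active m).filter fun v => v.1 ∈ C,
      (c.node ℓ - c.point v) * τ.1.eval (c.point v) = 1 := fun m ℓ =>
    exists_mul_eval_eq_one c.point_injective.injOn (hC ▸ c.card_active_filter_le m C)
      fun v _ => c.node_ne_point ℓ v
  choose τ hτ using this
  exact ⟨τ, fun m ℓ v hv hC => hτ m ℓ v (Finset.mem_filter.2 ⟨hv, hC⟩)⟩

/-- The sample space: the desired index, the messages with the storage noise, the query noise. -/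
abbrev Sample (K : Fin M → ℕ) : Type :=
  MsgIdx K ×
    ((i : MsgIdx K) → (Fin L → c.E) × (Fin L → degreeLT c.E (X * c.δ i.1))) ×
    ((i : MsgIdx K) → Fin L → degreeLT c.E (T * c.δ i.1))

noncomputable instance : Fintype (c.Sample K) := Fintype.ofFinite _

open scoped Classical in
/-- The share of the message `i` at the server `n`. -/
noncomputable def shareAt (i : MsgIdx K)
    (y : (Fin L → c.E) × (Fin L → degreeLT c.E (X * c.δ i.1))) (n : Fin N)
    (v : Σ n, Fin (c.d n)) (ℓ : Fin L) : c.E :=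
  -- Entries at inactive points or at virtual servers of other servers are padded by `0`, giving one
  -- alphabet for all shares.
  if v.1 = n ∧ v ∈ c.active i.1 then
    y.1 ℓ + (c.node ℓ - c.point v) * (y.2 ℓ).1.eval (c.point v) else 0

open scoped Classical in
/-- The query to the server `n` when the message `θ` is desired. -/
noncomputable def queryAt (θ : MsgIdx K) (z : (i : MsgIdx K) → Fin L → degreeLT c.E (T * c.δ i.1))
    (n : Fin N) (v : Σ n, Fin (c.d n)) (i : MsgIdx K) (ℓ : Fin L) : c.E :=
  if v.1 = n ∧ v ∈ c.active i.1 then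
    (if i = θ then 1 else 0) + (c.node ℓ - c.point v) * (z i ℓ).1.eval (c.point v) else 0

open scoped Classical in
/-- The answer of the virtual server `⟨n, j⟩`. -/
noncomputable def rawAnswer (n : Fin N) (q : (Σ n, Fin (c.d n)) → MsgIdx K → Fin L → c.E)
    (S : {i : MsgIdx K // n ∈ R i.1} → (Σ n, Fin (c.d n)) → Fin L → c.E) (j : Fin (c.d n)) : c.E :=
  -- Each message is weighted for its own set of active points, so that one decoding combination
  -- cancels the interference of all message sets together.
  ∑ i : {i : MsgIdx K // n ∈ R i.1}, Lagrange.nodalWeight (c.active i.1.1) c.point ⟨n, j⟩ *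
    ∑ ℓ, S i ⟨n, j⟩ ℓ * q ⟨n, j⟩ i.1 ℓ * (c.node ℓ - c.point ⟨n, j⟩)⁻¹

variable [Nonempty (MsgIdx K)]

instance : Nonempty (c.Sample K) := inferInstance

/-- The retrieval scheme of the code. -/
noncomputable def scheme (K : Fin M → ℕ) [Nonempty (MsgIdx K)] :
    Scheme F R K (L * c.width) where
  Ω := c.Sample K
  measurableSpace := ⊤
  μ := uniformMeasure (c.Sample K)
  isProbabilityMeasure := isProbabilityMeasure_uniformMeasure
  Share := (Σ n, Fin (c.d n)) → Fin L → c.E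
  Query := (Σ n, Fin (c.d n)) → MsgIdx K → Fin L → c.E
  message ω i := c.encode L (ω.2.1 i).1
  share ω i n := c.shareAt i (ω.2.1 i) n
  desired ω := ω.1
  query ω n := c.queryAt ω.1 ω.2.2 n
  answerFun n q S := List.ofFn (c.encode (c.d n) (c.rawAnswer n q S))
  measurable_message _ _ := trivial
  measurable_share _ _ := trivial
  measurable_desired _ _ := trivial
  measurable_query _ _ := trivial

/-- Separation of the messages from the other randomness, with shifted storage noise. -/
noncomputable def messageEquiv (τ : (m : Fin M) → Fin L → degreeLT c.E (X * c.δ m)) :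
    c.Sample K ≃ ((MsgIdx K → Fin L → c.E) × (MsgIdx K ×
      ((i : MsgIdx K) → Fin L → degreeLT c.E (X * c.δ i.1)) ×
      ((i : MsgIdx K) → Fin L → degreeLT c.E (T * c.δ i.1)))) where
  toFun ω := (fun i => (ω.2.1 i).1, ω.1, fun i ℓ => (ω.2.1 i).2 ℓ + (ω.2.1 i).1 ℓ • τ i.1 ℓ, ω.2.2)
  invFun y := (y.2.1, fun i => (y.1 i, fun ℓ => y.2.2.1 i ℓ - y.1 i ℓ • τ i.1 ℓ), y.2.2.2)
  left_inv ω := by simp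
  right_inv y := by simp

open scoped Classical in
/-- Separation of the desired index from the other randomness, with shifted query noise. -/
noncomputable def desiredEquiv (τ : (m : Fin M) → Fin L → degreeLT c.E (T * c.δ m)) :
    c.Sample K ≃ (MsgIdx K ×
      ((i : MsgIdx K) → (Fin L → c.E) × (Fin L → degreeLT c.E (X * c.δ i.1))) ×
      ((i : MsgIdx K) → Fin L → degreeLT c.E (T * c.δ i.1))) where
  toFun ω := (ω.1, ω.2.1, fun i ℓ => ω.2.2 i ℓ + (if i = ω.1 then (1 : c.E) else 0) • τ i.1 ℓ)
  invFun ω := (ω.1, ω.2.1, fun i ℓ => ω.2.2 i ℓ - (if i = ω.1 then (1 : c.E) else 0) • τ i.1 ℓ)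
  left_inv ω := by simp
  right_inv y := by simp

/-- Separation of the storage from the randomness of the user. -/
def storageEquiv : c.Sample K ≃
    ((i : MsgIdx K) → (Fin L → c.E) × (Fin L → degreeLT c.E (X * c.δ i.1))) ×
    (MsgIdx K × ((i : MsgIdx K) → Fin L → degreeLT c.E (T * c.δ i.1))) where
  toFun ω := (ω.2.1, ω.1, ω.2.2)
  invFun y := (y.2.1, y.1, y.2.2)
  left_inv _ := rfl
  right_inv _ := rfl

lemma recoverable (i : MsgIdx K) : DeterminedBy (c.scheme K).μ
    (fun ω => (c.scheme K).message ω i) (fun ω => (c.scheme K).share ω i) := by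
  classical
  have : Nonempty (c.scheme K).Ω := inferInstanceAs (Nonempty (c.Sample K))
  refine determinedBy_of_injective _ fun ω ω' h => ?_
  have h' : ∀ n : R i.1, c.shareAt i (ω.2.1 i) n = c.shareAt i (ω'.2.1 i) n := congrFun h
  have : (ω.2.1 i).1 = (ω'.2.1 i).1 := by
    funext ℓ
    have hcard : X * c.δ i.1 < (c.active i.1).card := by
      have := c.le_card_active i.1
      have := ℓ.pos
      omega
    refine eq_of_masked_eq (z := (ω.2.1 i).2 ℓ) (z' := (ω'.2.1 i).2 ℓ) (f := c.node ℓ)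
      c.point_injective.injOn hcard fun v hv => ?_
    have := congrFun (congrFun (h' ⟨v.1, (c.mem_active.1 hv).1⟩) v) ℓ
    simpa [shareAt, hv] using this
  change c.encode L _ = c.encode L _
  rw [this]

/-- At the points of `C`, `w + (f - α) z = (f - α) (z + w τ)`, and the shifted noise `z + w τ` is
uniform whatever `w` is. -/
lemma secure {C : Finset (Fin N)} (hC : C.card = X) : DiscreteIndep (c.scheme K).μ
    (fun ω (n : C) => (c.scheme K).storage ω n) (c.scheme K).message := by
  classical
  obtain ⟨τ, hτ⟩ := c.exists_cancel hC
  refine DiscreteIndep.symm ?_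
  have h := discreteIndep_of_equiv_prod (c.messageEquiv (K := K) τ) (fun w i => c.encode L (w i))
    (fun y (n : C) (i : {i : MsgIdx K // n.1 ∈ R i.1}) (v : Σ n, Fin (c.d n)) ℓ =>
      if v.1 = n ∧ v ∈ c.active i.1.1 then
        (c.node ℓ - c.point v) * (y.2.1 i ℓ).1.eval (c.point v) else 0)
  let _ : MeasurableSpace (c.Sample K) := ⊤
  refine DiscreteIndep.congr h (Eventually.of_forall fun ω => rfl) (Eventually.of_forall fun ω => ?_)
  funext n i v ℓ
  change (if _ then _ else _) = if _ then _ else _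
  split_ifs with hv
  · have := hτ i.1.1 ℓ v hv.2 (hv.1 ▸ n.2)
    simp only [messageEquiv, Equiv.coe_fn_mk, Submodule.coe_add, Submodule.coe_smul, eval_add,
      eval_smul, smul_eq_mul]
    linear_combination (ω.2.1 i.1).1 ℓ * this
  · rfl

/-- The same shift hides the indicator of the desired index in the query noise. -/
lemma isPrivate {C : Finset (Fin N)} (hC : C.card = T) : DiscreteIndep (c.scheme K).μ
    (fun ω (n : C) => (c.scheme K).query ω n) (c.scheme K).desired := by
  classical
  obtain ⟨τ, hτ⟩ := c.exists_cancel hC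
  refine DiscreteIndep.symm ?_
  have h := discreteIndep_of_equiv_prod (c.desiredEquiv (K := K) τ) (fun θ => θ)
    (fun y (n : C) (v : Σ n, Fin (c.d n)) (i : MsgIdx K) ℓ =>
      if v.1 = n ∧ v ∈ c.active i.1 then
        (c.node ℓ - c.point v) * (y.2 i ℓ).1.eval (c.point v) else 0)
  let _ : MeasurableSpace (c.Sample K) := ⊤
  refine DiscreteIndep.congr h (Eventually.of_forall fun ω => rfl) (Eventually.of_forall fun ω => ?_)
  funext n v i ℓ
  change (if _ then _ else _) = if _ then _ else _
  by_cases hv : v.1 = n ∧ v ∈ c.active i.1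
  · have := hτ i.1 ℓ v hv.2 (hv.1 ▸ n.2)
    simp only [if_pos hv, desiredEquiv, Equiv.coe_fn_mk, Submodule.coe_add, Submodule.coe_smul,
      eval_add, eval_smul, smul_eq_mul]
    by_cases hi : i = ω.1
    · simp only [if_pos hi]
      linear_combination this
    · simp only [if_neg hi]
      ring
  · simp only [if_neg hv]

/-- Messages inactive at the point contribute `0`, so the sum may run over all messages and be
exchanged with the sum over points. -/
lemma rawAnswer_eq (ω : c.Sample K) (n : Fin N) (j : Fin (c.d n)) [DecidableEq (Σ n, Fin (c.d n))]
    [DecidableEq (MsgIdx K)] :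
    c.rawAnswer n ((c.scheme K).query ω n) ((c.scheme K).storage ω n) j =
      ∑ i : MsgIdx K, if (⟨n, j⟩ : Σ n, Fin (c.d n)) ∈ c.active i.1 then
        Lagrange.nodalWeight (c.active i.1) c.point ⟨n, j⟩ * ∑ ℓ,
          ((ω.2.1 i).1 ℓ + (c.node ℓ - c.point ⟨n, j⟩) *
            ((ω.2.1 i).2 ℓ).1.eval (c.point ⟨n, j⟩)) *
          ((if i = ω.1 then 1 else 0) + (c.node ℓ - c.point ⟨n, j⟩) *
            (ω.2.2 i ℓ).1.eval (c.point ⟨n, j⟩)) * (c.node ℓ - c.point ⟨n, j⟩)⁻¹ else 0 := by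
  classical
  rw [← Finset.sum_filter_of_ne (p := fun i : MsgIdx K => n ∈ R i.1) (fun i _ hi => by
    by_contra hcon
    exact hi (if_neg fun hmem => hcon (c.mem_active.1 hmem).1)),
    Finset.sum_subtype _ (p := fun i : MsgIdx K => n ∈ R i.1) (by simp)]
  unfold rawAnswer
  refine Finset.sum_congr rfl fun i _ => ?_
  by_cases hv : (⟨n, j⟩ : Σ n, Fin (c.d n)) ∈ c.active i.1.1
  · rw [if_pos hv]
    refine congrArg₂ _ (by congr!) (Finset.sum_congr rfl fun ℓ _ => ?_)
    have e1 : (c.scheme K).storage ω n i ⟨n, j⟩ ℓ = (ω.2.1 i.1).1 ℓ +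
        (c.node ℓ - c.point ⟨n, j⟩) * ((ω.2.1 i.1).2 ℓ).1.eval (c.point ⟨n, j⟩) :=
      if_pos ⟨rfl, hv⟩
    have e2 : (c.scheme K).query ω n ⟨n, j⟩ i.1 ℓ = (if i.1 = ω.1 then (1 : c.E) else 0) +
        (c.node ℓ - c.point ⟨n, j⟩) * (ω.2.2 i.1 ℓ).1.eval (c.point ⟨n, j⟩) := by
      refine (if_pos ⟨rfl, hv⟩).trans ?_
      congr!
    rw [e1, e2]
  · rw [if_neg hv]
    have : ∀ ℓ, (c.scheme K).storage ω n i ⟨n, j⟩ ℓ = (0 : c.E) := fun ℓ =>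
      if_neg fun h => hv h.2
    simp_rw [this]
    simp

/-- Weighting the answers by the `ℓ`-th Lagrange basis polynomial of the nodes isolates symbol `ℓ`;
undesired messages vanish because their query secret is `0`. -/
lemma decode_eq (ω : c.Sample K) (ℓ : Fin L) [DecidableEq (Fin L)] :
    (ω.2.1 ω.1).1 ℓ = (Lagrange.nodal (c.active ω.1.1) c.point).eval (c.node ℓ) *
      ∑ v : Σ n, Fin (c.d n), (Lagrange.basis Finset.univ c.node ℓ).eval (c.point v) *
        c.rawAnswer v.1 ((c.scheme K).query ω v.1) ((c.scheme K).storage ω v.1) v.2 := by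
  classical
  set u := Lagrange.basis Finset.univ c.node ℓ with hu
  have hdeg : u.degree < L := by
    rw [hu, Lagrange.degree_basis c.node_injective.injOn (Finset.mem_univ ℓ), Finset.card_univ,
      Fintype.card_fin]
    have := ℓ.pos
    exact_mod_cast (by omega : L - 1 < L)
  have hval : ∀ ℓ', u.eval (c.node ℓ') = if ℓ' = ℓ then 1 else 0 := by
    intro ℓ'
    split_ifs with h
    · subst h
      exact Lagrange.eval_basis_self c.node_injective.injOn (Finset.mem_univ _)
    · exact Lagrange.eval_basis_of_ne (Ne.symm h) (Finset.mem_univ _)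
  simp_rw [rawAnswer_eq, Finset.mul_sum (s := (Finset.univ : Finset (MsgIdx K)))]
  rw [Finset.sum_comm]
  have hi : ∀ i : MsgIdx K, ∑ v : Σ n, Fin (c.d n), u.eval (c.point v) *
      (if v ∈ c.active i.1 then Lagrange.nodalWeight (c.active i.1) c.point v * ∑ ℓ,
          ((ω.2.1 i).1 ℓ + (c.node ℓ - c.point v) * ((ω.2.1 i).2 ℓ).1.eval (c.point v)) *
          ((if i = ω.1 then 1 else 0) + (c.node ℓ - c.point v) *
            (ω.2.2 i ℓ).1.eval (c.point v)) * (c.node ℓ - c.point v)⁻¹ else 0) =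
      if i = ω.1 then (ω.2.1 i).1 ℓ *
        ((Lagrange.nodal (c.active i.1) c.point).eval (c.node ℓ))⁻¹ else 0 := by
    intro i
    have := decode_identity (P := c.active i.1) c.point_injective.injOn (c.le_card_active i.1)
      (f := c.node) (fun ℓ a _ => c.node_ne_point ℓ a) hdeg (if i = ω.1 then 1 else 0)
      (ω.2.1 i).1 (ω.2.1 i).2 (ω.2.2 i)
    simp only [mul_ite, mul_zero, ← Finset.sum_filter, Finset.filter_univ_mem]
    rw [this]
    simp [hval]
  rw [Finset.sum_congr rfl fun i _ => hi i, Finset.sum_ite_eq' Finset.univ ω.1,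
    if_pos (Finset.mem_univ _)]
  have hnod : (Lagrange.nodal (c.active ω.1.1) c.point).eval (c.node ℓ) ≠ 0 :=
    Lagrange.eval_nodal_not_at_node fun v _ => c.node_ne_point ℓ v
  field_simp

lemma correct : DeterminedBy (c.scheme K).μ
    (fun ω => (c.scheme K).message ω ((c.scheme K).desired ω))
    (fun ω => ((c.scheme K).answer ω, (c.scheme K).query ω, (c.scheme K).desired ω)) := by
  classical
  have : Nonempty (c.scheme K).Ω := inferInstanceAs (Nonempty (c.Sample K))
  refine determinedBy_of_injective _ fun (ω ω' : c.Sample K) h => ?_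
  simp only [Prod.mk.injEq] at h
  have hd : ω.1 = ω'.1 := h.2.2
  have hraw : ∀ v : Σ n, Fin (c.d n),
      c.rawAnswer v.1 ((c.scheme K).query ω v.1) ((c.scheme K).storage ω v.1) v.2 =
      c.rawAnswer v.1 ((c.scheme K).query ω' v.1) ((c.scheme K).storage ω' v.1) v.2 := by
    intro v
    have h1 := congrFun h.1 v.1
    exact congrFun ((c.encode (c.d v.1)).injective (List.ofFn_injective h1)) v.2
  have : (ω.2.1 ω.1).1 = (ω'.2.1 ω'.1).1 := by
    funext ℓ
    refine (c.decode_eq ω ℓ).trans (Eq.trans ?_ (c.decode_eq ω' ℓ).symm)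
    rw [hd]
    exact congrArg _ (Finset.sum_congr rfl fun v _ => congrArg _ (hraw v))
  change c.encode L _ = c.encode L _
  exact congrArg _ this

lemma length_answer (ω : (c.scheme K).Ω) (n : Fin N) :
    ((c.scheme K).answer ω n).length = c.d n * c.width := List.length_ofFn

lemma message_uniform [Fintype F] : IsUniform (c.scheme K).μ (c.scheme K).message := by
  have h := isUniform_of_equiv_prod (c.messageEquiv (K := K) 0)
    (Equiv.piCongrRight fun _ : MsgIdx K => c.encode L)
  exact h

lemma share_indep : MutuallyIndep (c.scheme K).μ (fun i ω => (c.scheme K).share ω i) := by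
  have h := mutuallyIndep_of_equiv_pi (c.storageEquiv (K := K))
    fun i y (n : R i.1) => c.shareAt i y n
  exact h

lemma desired_uniform : IsUniform (c.scheme K).μ (c.scheme K).desired := by
  have h := isUniform_of_equiv_prod (Equiv.refl (c.Sample K)) (Equiv.refl _)
  exact h

lemma no_prior : DiscreteIndep (c.scheme K).μ (c.scheme K).storage
    (fun ω => ((c.scheme K).desired ω, (c.scheme K).query ω)) := by
  have h := discreteIndep_of_equiv_prod (c.storageEquiv (K := K))
    (fun y n (i : {i : MsgIdx K // n ∈ R i.1}) => c.shareAt i.1 (y i) n)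
    (fun y => (y.1, c.queryAt y.1 y.2))
  exact h

lemma prefix_free (n : Fin N) (q : (c.scheme K).Query) (a b : List F)
    (ha : (c.scheme K).μ {ω | (c.scheme K).query ω n = q ∧ (c.scheme K).answer ω n = a} ≠ 0)
    (hb : (c.scheme K).μ {ω | (c.scheme K).query ω n = q ∧ (c.scheme K).answer ω n = b} ≠ 0)
    (hab : a <+: b) : a = b := by
  obtain ⟨ω, _, rfl⟩ := nonempty_of_measure_ne_zero ha
  obtain ⟨ω', _, rfl⟩ := nonempty_of_measure_ne_zero hb
  exact hab.eq_of_length (by rw [length_answer, length_answer])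

theorem feasible [Fintype F] : (c.scheme K).Feasible X T where
  message_uniform := c.message_uniform
  recoverable := c.recoverable
  share_indep := c.share_indep
  secure _ hC := c.secure hC
  desired_uniform := c.desired_uniform
  no_prior := c.no_prior
  isPrivate _ hC := c.isPrivate hC
  prefix_free := c.prefix_free
  correct := c.correct

lemma rate_scheme (hw : 0 < c.width) :
    (c.scheme K).rate = (L : ℝ≥0∞) / (∑ n, c.d n : ℕ) := by
  have hd : (c.scheme K).download = ((∑ n, c.d n) * c.width : ℕ) := by
    unfold Scheme.download
    simp_rw [length_answer]
    rw [lintegral_const, measure_univ, mul_one, ← Nat.cast_sum, Finset.sum_mul]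
  rw [Scheme.rate, hd, Nat.cast_mul, Nat.cast_mul]
  exact ENNReal.mul_div_mul_right _ _ (by exact_mod_cast hw.ne') (by simp)

end AlignmentCode

end GXSTPIR

/-! ### Existence of codes and the achievable rate. -/

namespace GXSTPIR

/-- Every power of the order of a finite field is the order of a finite field. -/
lemma exists_field_card_eq (F : Type) [Field F] [Fintype F] {e : ℕ} (he : e ≠ 0) :
    ∃ (E : Type) (_ : Field E) (_ : Fintype E), Fintype.card E = Fintype.card F ^ e := by
  obtain ⟨p, _⟩ := CharP.exists F
  obtain ⟨n, hp, hn⟩ := FiniteField.card F p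
  have : Fact p.Prime := ⟨hp⟩
  have hne : (n : ℕ) * e ≠ 0 := mul_ne_zero n.ne_zero he
  have : Finite (GaloisField p (n * e)) := Nat.finite_of_card_ne_zero (by
    rw [GaloisField.card p _ hne]
    exact pow_ne_zero _ hp.ne_zero)
  let _ : Fintype (GaloisField p (n * e)) := Fintype.ofFinite _
  refine ⟨GaloisField p (n * e), inferInstance, inferInstance, ?_⟩
  rw [← Nat.card_eq_fintype_card, GaloisField.card p _ hne, hn, pow_mul]

/-- Truncation at a suitable threshold leaves the sum over all servers but the `k` largest ones. -/
lemma exists_threshold {ι : Type} {A : Finset ι} (d : ι → ℕ) {k L : ℕ} (hk : 0 < k)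
    (hkA : k ≤ A.card) (h : ∀ B ⊆ A, B.card + k = A.card → L ≤ ∑ n ∈ B, d n) :
    ∃ δ, L + k * δ ≤ ∑ n ∈ A, min (d n) δ := by
  classical
  have hbdd : ∀ t, k ≤ (A.filter fun n => t ≤ d n).card → t ≤ ∑ n ∈ A, d n := by
    intro t ht
    obtain ⟨n, hn⟩ := Finset.card_pos.1 (hk.trans_le ht)
    rw [Finset.mem_filter] at hn
    exact hn.2.trans (Finset.single_le_sum (fun _ _ => Nat.zero_le _) hn.1)
  -- `δ` is the `k`-th largest value of `d` on `A`. Then `C` collects `k` largest servers, each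
  -- truncated to `δ`, while the others are at most `δ` and keep their values.
  set P : ℕ → Prop := fun t => k ≤ (A.filter fun n => t ≤ d n).card
  set δ := Nat.findGreatest P (∑ n ∈ A, d n)
  have h0 : P 0 := by simpa [P] using hkA
  have hδ : P δ := Nat.findGreatest_spec (Nat.zero_le _) h0
  have hδ' : ¬ P (δ + 1) := fun hP =>
    (Nat.le_findGreatest (hbdd _ hP) hP).not_gt (Nat.lt_succ_self δ)
  obtain ⟨C, h1, h2, h3⟩ := Finset.exists_subsuperset_card_eq
    (s := A.filter fun n => δ + 1 ≤ d n) (t := A.filter fun n => δ ≤ d n) (n := k)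
    (Finset.monotone_filter_right A fun n _ hn => (Nat.le_succ δ).trans hn) (not_le.1 hδ').le hδ
  have hCA : C ⊆ A := h2.trans (Finset.filter_subset _ _)
  refine ⟨δ, ?_⟩
  rw [← Finset.sum_sdiff hCA]
  refine add_le_add ?_ ?_
  · refine (h (A \ C) Finset.sdiff_subset (by
      rw [← h3, Finset.card_sdiff_add_card_eq_card hCA])).trans ?_
    refine Finset.sum_le_sum fun n hn => le_min le_rfl ?_
    rw [Finset.mem_sdiff] at hn
    by_contra hcon
    exact hn.2 (h1 (Finset.mem_filter.2 ⟨hn.1, by omega⟩))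
  · rw [← h3, ← smul_eq_mul]
    exact Finset.card_nsmul_le_sum _ _ _ fun n hn =>
      le_min (Finset.mem_filter.1 (h2 hn)).2 le_rfl

/-- Integral solutions of the linear program are achieved. -/
lemma le_capacity {F : Type} [Field F] [Fintype F] {N M : ℕ} {R : Fin M → Finset (Fin N)}
    {X T : ℕ} (hM : 0 < M) (hT : 1 ≤ T) (hR : ∀ m, X + T < (R m).card) {K : Fin M → ℕ}
    (hK : ∀ m, 0 < K m) {L : ℕ} {d : Fin N → ℕ} (hL : 0 < L)
    (hd : ∀ m, ∀ R' ⊆ R m, R'.card + X + T = (R m).card → L ≤ ∑ n ∈ R', d n) :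
    (L : ℝ≥0∞) / (∑ n, d n : ℕ) ≤ capacity F R X T K := by
  classical
  have hδ : ∀ m, ∃ δ, L + (X + T) * δ ≤ ∑ n ∈ R m, min (d n) δ := fun m =>
    exists_threshold d (by omega) (hR m).le fun B hB hc => hd m B hB (by omega)
  choose δ hδ using hδ
  have : Nonempty (MsgIdx K) := ⟨⟨⟨0, hM⟩, ⟨0, hK _⟩⟩⟩
  -- More than the number of points and nodes; since `q ^ e > e`, the extension field has room for
  -- distinct ones.
  set e := Fintype.card ((Σ n, Fin (d n)) ⊕ Fin L) + 1
  obtain ⟨E, _, _, hE⟩ := exists_field_card_eq F (e := e) (Nat.succ_ne_zero _)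
  obtain ⟨g⟩ : Nonempty (((Σ n, Fin (d n)) ⊕ Fin L) ↪ E) := by
    refine Function.Embedding.nonempty_of_card_le ?_
    rw [hE]
    exact (Nat.le_succ _).trans (Nat.lt_pow_self Fintype.one_lt_card).le
  let c : AlignmentCode F R X T L :=
    { E := E
      d := d
      δ := δ
      point := fun v => g (Sum.inl v)
      node := fun ℓ => g (Sum.inr ℓ)
      point_injective := g.injective.comp Sum.inl_injective
      node_injective := g.injective.comp Sum.inr_injective
      node_ne_point := fun ℓ v h => Sum.inr_ne_inl (g.injective h)
      width := e
      encode := fun k => Fintype.equivOfCardEq (by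
        rw [Fintype.card_fun, Fintype.card_fun, Fintype.card_fin, Fintype.card_fin, hE, ← pow_mul,
          mul_comm])
      le_sum_min := fun m => by
        rw [← add_mul]
        exact hδ m }
  have hw : 0 < c.width := Nat.succ_pos _
  have h1 : (c.scheme K).rate = (L : ℝ≥0∞) / (∑ n, d n : ℕ) := c.rate_scheme hw
  rw [← h1]
  exact le_iSup₂_of_le (L * c.width) (Nat.mul_pos hL hw)
    (le_iSup₂_of_le (c.scheme K) c.feasible le_rfl)

end GXSTPIR

/-! ### The asymptotic capacity. -/

theorem corollary1 {F : Type} [Field F] [Fintype F] {N M : ℕ} (hM : 0 < M)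
    (R : Fin M → Finset (Fin N)) (hR : ∀ m, (R m).Nonempty)
    (X T : ℕ) (hX : X < N) (hT : 1 ≤ T) (hTN : T < N) :
    ((∃ m, (R m).card ≤ X + T) →
      Tendsto (fun K : Fin M → ℕ => GXSTPIR.capacity F R X T K) atTop (𝓝 0)) ∧
    ((∀ m, X + T < (R m).card) →
      ∃ c : ℝ, IsGreatest ((fun D : Fin N → ℝ => (∑ n, D n)⁻¹) '' GXSTPIR.feasibleRegion R X T) c ∧
        Tendsto (fun K : Fin M → ℕ => GXSTPIR.capacity F R X T K) atTop
          (𝓝 (ENNReal.ofReal c))) := by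
  have heval : ∀ m, Tendsto (fun K : Fin M → ℕ => K m) atTop atTop := fun m =>
    tendsto_atTop.2 fun b =>
    (eventually_ge_atTop fun _ => b).mono fun K h => h m
  have hinv : ∀ m, Tendsto (fun K : Fin M → ℕ => (K m : ℝ)⁻¹) atTop (𝓝 0) := fun m =>
    tendsto_inv_atTop_nhds_zero_nat.comp (heval m)
  have hpos : ∀ᶠ K : Fin M → ℕ in atTop, ∀ m, 0 < K m :=
    eventually_all.2 fun m => (heval m).eventually_gt_atTop 0
  constructor
  · rintro ⟨m, hm⟩
    have h1 := ENNReal.tendsto_ofReal (hinv m)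
    rw [ENNReal.ofReal_zero] at h1
    refine tendsto_of_tendsto_of_tendsto_of_le_of_le' tendsto_const_nhds h1
      (Eventually.of_forall fun K => zero_le) ?_
    filter_upwards [hpos] with K hK
    exact GXSTPIR.capacity_le_inv_of_card_le hX hT hTN hm (hK m)
  · intro hρ
    obtain ⟨D, hD, hmin⟩ := GXSTPIR.exists_min_feasibleRegion hρ
    have hmax : ∀ D' ∈ GXSTPIR.feasibleRegion R X T, (∑ n, D' n)⁻¹ ≤ (∑ n, D n)⁻¹ :=
      fun D' hD' => inv_anti₀
        (zero_lt_one.trans_le (GXSTPIR.one_le_sum_of_mem_feasibleRegion hM hρ hD)) (hmin D' hD')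
    refine ⟨(∑ n, D n)⁻¹, ⟨⟨D, hD, rfl⟩, ?_⟩, ?_⟩
    · rintro _ ⟨D', hD', rfl⟩
      exact hmax D' hD'
    have h1 : Tendsto (fun K : Fin M → ℕ => ENNReal.ofReal ((∑ n, D n)⁻¹ + ∑ m, (K m : ℝ)⁻¹))
        atTop (𝓝 (ENNReal.ofReal ((∑ n, D n)⁻¹ + ∑ _m : Fin M, 0))) :=
      ENNReal.tendsto_ofReal (tendsto_const_nhds.add (tendsto_finsetSum _ fun m _ => hinv m))
    rw [Finset.sum_const_zero, add_zero] at h1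
    refine tendsto_of_tendsto_of_tendsto_of_le_of_le' tendsto_const_nhds h1 ?_ ?_
    -- The lower bound holds for all positive `K`; only the upper bound needs the limit.
    · filter_upwards [hpos] with K hK
      exact GXSTPIR.ofReal_inv_le_of_forall_nat hM hρ hD fun L d hL hd =>
        GXSTPIR.le_capacity hM hT hρ hK hL hd
    · filter_upwards [hpos] with K hK
      exact GXSTPIR.capacity_le_of_isGreatest hM hX hT hTN hρ hK
        (inv_nonneg.2 (Finset.sum_nonneg fun n _ => hD.1 n)) hmax
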